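/- Conventions. Let $A\subseteq B$ be an inclusion of C*-algebras with $A\neq0$. "Ideal" means closed two-sided ideal, and $A^+$, $B^+$ are the cones of positive elements. A \emph{generalised expectation} for $A\subseteq B$ consists of a C*-inclusion $A\subseteq\tilde A$ and a completely positive contraction $E\colon B\to\tilde A$ with $E|_A=\mathrm{id}_A$. Let $\mathcal N_E$ be the closed linear span of all ideals of $B$ contained in $\ker E$, and let $\Lambda\colon B\to B/\mathcal N_E$ be the quotient map. $E$ is \emph{almost faithful} if $b=0$ is the only $b\in B$ with $E((bc)^*bc)=0$ for all $c\in B$. $E$ is \emph{supportive} if for every $b\in B^+$ with $E(b)\ne0$ there are $\delta>0$ and a nonzero hereditary C*-subalgebra $D\subseteq A$ with $\|xE(b)x\|\ge\delta$ for all $x\in D^+$ with $\|x\|=1$. $E$ is an \emph{essentially defined conditional expectation} if it takes values in the local multiplier algebra $\mathcal M_{\mathrm{loc}}(A)$, the C*-algebraic inductive limit of the multiplier algebras $\mathcal M(I)$ over the essential ideals $I$ of $A$; this includes genuine conditional expectations $E\colon B\to A$, as $A\subseteq\mathcal M_{\mathrm{loc}}(A)$. The inclusion $A\subseteq B$ is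 \emph{aperiodic} if for every $b\in B$, every nonzero hereditary C*-subalgebra $D\subseteq A$ and every $\varepsilon>0$ there is $a\in D^+$ with $\|a\|=1$ such that the norm of the class of $aba$ in the Banach space $B/A$ is less than $\varepsilon$. For positive elements $a,b$ of a C*-algebra, $a\precsim b$ (Cuntz preorder) means that for every $\varepsilon>0$ there is $x$ in this algebra with $\|a-x^*bx\|<\varepsilon$. For an inclusion $A\subseteq C$: $A^+$ \emph{supports} $C$ if for each $c\in C^+\setminus\{0\}$ there is $a\in A^+\setminus\{0\}$ with $a\precsim c$ in $C$; $A$ \emph{detects ideals} in $C$ if $J\cap A\ne0$ for every nonzero ideal $J$ of $C$. The \emph{hidden ideal} for $A\subseteq B$ is the unique maximal element, if there is one, among the ideals $J$ of $B$ with $J\cap A=0$. $A$ is \emph{$B$-minimal} if $\overline{BIB}=B$ (closed linear span) for every nonzero ideal $I$ of $A$. An element $a\in B^+\setminus\{0\}$ is \emph{infinite} in $B$ if there is $b\in B^+\setminus\{0\}$ such that for all $\varepsilon>0$ there are $x,y\in aB$ with $\|x^*x-a\|<\varepsilon$, $\|y^*y-b\|<\varepsilon$ and $\|x^*y\|<\varepsilon$.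 $B$ is \emph{purely infinite} if it has no characters (nonzero $*$-homomorphisms to $\mathbb C$) and $a\precsim b$ for all $a,b\in B^+$ such that $a$ belongs to the ideal generated by $b$. Theorem. Let $A\subseteq B$ be an aperiodic C*-inclusion with $A\ne0$. Let $E\colon B\to\tilde A\supseteq A$ be a generalised expectation that is supportive or is an essentially defined conditional expectation; in the latter case $E$ is automatically supportive. Then: \begin{enumerate} \item for every $b\in B^+$ with $b\notin\mathcal N_E$ there is $a\in A^+\setminus\{0\}$ with $a\precsim b$ in $B$; \item $A^+$ supports $B/\mathcal N_E$; \item $A$ detects ideals in $B/\mathcal N_E$; \item $\mathcal N_E$ is the hidden ideal for $A\subseteq B$, and so the following hold: $B/\mathcal N_E$ is the unique quotient of $B$ in which $A$ embeds and detects ideals; every ideal $J$ of $B$ with $J\cap A=0$ is contained in $\ker E$, and even in $\mathcal N_E$; and for every C*-algebra $C$ and every $*$-homomorphism $\pi\colon B\to C$ that is injective on $A$, there is a $*$-homomorphism $\varphi\colon\pi(B)\to B/\mathcal N_E$ with $\varphi\circ\pi=\Lambda$, and there is a generalised expectation $E_\pi\colon\pi(B)\to\tilde A$ for the inclusion $A\cong\pi(A)\subseteq\pi(B)$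 with $E_\pi\circ\pi=E$; \item $B$ is simple if and only if $A$ is $B$-minimal and $E$ is almost faithful; \item if $B$ is simple, then $B$ is purely infinite if and only if every element of $A^+\setminus\{0\}$ is infinite in $B$. \end{enumerate} -/

import Mathlib

namespace AperiodicInclusion

open Filter Topology

/-- A closed two-sided ideal of a C*-algebra. -/
structure ClosedIdeal (B : Type*) [NonUnitalCStarAlgebra B] extends Submodule ℂ B where
  mul_mem_left' : ∀ (b : B) {x : B}, x ∈ carrier → b * x ∈ carrier
  mul_mem_right' : ∀ (b : B) {x : B}, x ∈ carrier → x * b ∈ carrier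
  isClosed' : IsClosed carrier

namespace ClosedIdeal

section Basic

variable {B : Type*} [NonUnitalCStarAlgebra B]

instance : SetLike (ClosedIdeal B) B where
  coe J := J.carrier
  coe_injective := by
    rintro ⟨⟨⟨⟨_, _⟩, _⟩, _⟩, _, _, _⟩ ⟨⟨⟨⟨_, _⟩, _⟩, _⟩, _, _, _⟩ h
    simpa using! h

/-- Closed ideals are ordered by inclusion. -/
instance : PartialOrder (ClosedIdeal B) := .ofSetLike (ClosedIdeal B) B

theorem mul_mem_left (J : ClosedIdeal B) (b : B) {x : B} (hx : x ∈ J) : b * x ∈ J :=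
  J.mul_mem_left' b hx

theorem mul_mem_right (J : ClosedIdeal B) (b : B) {x : B} (hx : x ∈ J) : x * b ∈ J :=
  J.mul_mem_right' b hx

instance isClosed (J : ClosedIdeal B) : IsClosed (J : Set B) := J.isClosed'

instance isClosed_toSubmodule (J : ClosedIdeal B) : IsClosed (J.toSubmodule : Set B) :=
  J.isClosed'

instance : NonUnitalSubringClass (ClosedIdeal B) B where
  add_mem {J} _ _ hx hy := J.toSubmodule.add_mem hx hy
  zero_mem J := J.toSubmodule.zero_mem
  neg_mem {J} _ hx := J.toSubmodule.neg_mem hx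
  mul_mem {J} x _ _ hy := J.mul_mem_left x hy

instance : SMulMemClass (ClosedIdeal B) ℂ B where
  smul_mem {J} c _ hx := J.toSubmodule.smul_mem c hx

theorem norm_sub_mul_le {e : B} (he : ∃ s : B, e = star s * s) (he' : ‖e‖ ≤ 1) (z : B) :
    ‖z - z * e‖ ≤ ‖z‖ := by
  let := CStarAlgebra.spectralOrder B
  have := CStarAlgebra.spectralOrderedRing B
  obtain ⟨s, rfl⟩ := he
  have h0 : (0 : B) ≤ star s * s := star_mul_self_nonneg s
  have := CStarAlgebra.norm_sub_mul_self_le_of_inr (x := (0 : B)) (y := star s * s) (star z)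
    le_rfl h0 he' (norm_nonneg z) (by
      rw [Unitization.inr_zero, sub_zero, mul_one, ← Unitization.inr_star, ← Unitization.inr_mul,
        Unitization.norm_inr, star_star, CStarRing.norm_self_mul_star, sq])
  rw [← norm_star]
  simpa [star_mul, mul_assoc] using this

/-- The part of a closed ideal that is a star subalgebra by construction. -/
def starPart (J : ClosedIdeal B) : NonUnitalStarSubalgebra ℂ B where
  carrier := {x | x ∈ J ∧ star x ∈ J}
  add_mem' hx hy := ⟨add_mem hx.1 hy.1, by rw [star_add]; exact add_mem hx.2 hy.2⟩
  zero_mem' := ⟨zero_mem J, by rw [star_zero]; exact zero_mem J⟩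
  mul_mem' hx hy := ⟨mul_mem hx.1 hy.1, by rw [star_mul]; exact mul_mem hy.2 hx.2⟩
  smul_mem' c x hx := ⟨SMulMemClass.smul_mem c hx.1, by
    rw [star_smul]; exact SMulMemClass.smul_mem _ hx.2⟩
  star_mem' hx := ⟨hx.2, by rw [star_star]; exact hx.1⟩

theorem isClosed_starPart (J : ClosedIdeal B) : IsClosed (J.starPart : Set B) :=
  J.isClosed.inter (J.isClosed.preimage continuous_star)

/-- Approximate units: `c` may be approximated by `c * e` with `0 ≤ e`, `‖e‖ ≤ 1`. -/
theorem exists_approx_starPart (J : ClosedIdeal B) {c : B} (hc : c ∈ J.starPart) {ε : ℝ}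
    (hε : 0 < ε) : ∃ e ∈ J, (∃ s : B, e = star s * s) ∧ ‖e‖ ≤ 1 ∧ ‖c - c * e‖ < ε := by
  have : IsClosed (J.starPart : Set B) := J.isClosed_starPart
  let := CStarAlgebra.spectralOrder J.starPart
  have := CStarAlgebra.spectralOrderedRing J.starPart
  have hl := CStarAlgebra.increasingApproximateUnit (A := J.starPart)
  have := hl.neBot
  have h1 := hl.tendsto_mul_left ⟨c, hc⟩
  have h2 := (Metric.tendsto_nhds.1 h1 ε hε).and (hl.eventually_nonneg.and hl.eventually_norm)
  obtain ⟨e, he, he0, he1⟩ := h2.exists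
  refine ⟨e, e.2.1, ?_, he1, ?_⟩
  · obtain ⟨s, hs⟩ := CStarAlgebra.nonneg_iff_eq_star_mul_self.1 he0
    exact ⟨s, by rw [hs]; rfl⟩
  · rw [dist_eq_norm, ← norm_neg] at he
    rw [← neg_sub]
    simpa using! he

/-- Closed ideals are automatically closed under the involution. -/
instance : StarMemClass (ClosedIdeal B) B where
  star_mem {J} x hx := by
    have hc : star x * x ∈ J.starPart :=
      ⟨J.mul_mem_left _ hx, by rw [star_mul, star_star]; exact J.mul_mem_left _ hx⟩
    change star x ∈ (J : Set B)
    rw [← J.isClosed.closure_eq, Metric.mem_closure_iff]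
    intro ε hε
    obtain ⟨e, heJ, hs, he1, he⟩ := J.exists_approx_starPart hc (ε := ε ^ 2 / 2) (by positivity)
    have hes : star e = e := by obtain ⟨s, rfl⟩ := hs; simp
    refine ⟨e * star x, J.mul_mem_right _ heJ, ?_⟩
    have h1 : ‖x - x * e‖ ^ 2 < ε ^ 2 := by
      rw [sq, ← CStarRing.norm_star_mul_self]
      have : star (x - x * e) * (x - x * e)
          = (star x * x - star x * x * e) - e * (star x * x - star x * x * e) := by
        simp only [star_sub, star_mul, hes]
        noncomm_ring
      rw [this]
      calc _ ≤ ‖star x * x - star x * x * e‖ + ‖e * (star x * x - star x * x * e)‖ :=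
            norm_sub_le _ _
        _ ≤ ‖star x * x - star x * x * e‖ + 1 * ‖star x * x - star x * x * e‖ := by
            gcongr
            exact (norm_mul_le _ _).trans (by gcongr)
        _ < _ := by linarith
    have h2 : star x - e * star x = star (x - x * e) := by simp [star_mul, hes]
    rw [dist_eq_norm, h2, norm_star]
    exact lt_of_pow_lt_pow_left₀ 2 hε.le h1

theorem exists_approx (J : ClosedIdeal B) {c : B} (hc : c ∈ J) {ε : ℝ}
    (hε : 0 < ε) : ∃ e ∈ J, (∃ s : B, e = star s * s) ∧ ‖e‖ ≤ 1 ∧ ‖c - c * e‖ < ε :=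
  J.exists_approx_starPart ⟨hc, star_mem hc⟩ hε

end Basic

section Quot

variable {B : Type*} [NonUnitalCStarAlgebra B] (J : ClosedIdeal B)

/-- The quotient C*-algebra `B / J`, with the quotient norm. -/
def Quot : Type _ := B ⧸ J.toSubmodule

noncomputable instance : NormedAddCommGroup J.Quot :=
  inferInstanceAs (NormedAddCommGroup (B ⧸ J.toSubmodule))

noncomputable instance : NormedSpace ℂ J.Quot :=
  inferInstanceAs (NormedSpace ℂ (B ⧸ J.toSubmodule))

instance : CompleteSpace J.Quot :=
  inferInstanceAs (CompleteSpace (B ⧸ J.toSubmodule))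

/-- The quotient map, as a linear map. -/
def mkₗ : B →ₗ[ℂ] J.Quot := J.toSubmodule.mkQ

theorem mkₗ_surjective : Function.Surjective J.mkₗ := J.toSubmodule.mkQ_surjective

theorem mkₗ_eq_iff {x y : B} : J.mkₗ x = J.mkₗ y ↔ x - y ∈ J :=
  Submodule.Quotient.eq J.toSubmodule

theorem norm_mkₗ_le (x : B) : ‖J.mkₗ x‖ ≤ ‖x‖ := Submodule.Quotient.norm_mk_le J.toSubmodule x

theorem exists_norm_lt (q : J.Quot) {ε : ℝ} (hε : 0 < ε) :
    ∃ x : B, J.mkₗ x = q ∧ ‖x‖ < ‖q‖ + ε :=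
  Submodule.Quotient.norm_mk_lt (S := J.toSubmodule) q hε

instance : Mul J.Quot where
  mul := Quotient.map₂ (· * ·) (by
    intro a a' ha b b' hb
    have ha' : a - a' ∈ J := (Submodule.quotientRel_def J.toSubmodule).1 ha
    have hb' : b - b' ∈ J := (Submodule.quotientRel_def J.toSubmodule).1 hb
    refine (Submodule.quotientRel_def J.toSubmodule).2 ?_
    have : a * b - a' * b' = (a - a') * b + a' * (b - b') := by noncomm_ring
    rw [this]
    exact add_mem (J.mul_mem_right _ ha') (J.mul_mem_left _ hb'))

instance : Star J.Quot where
  star := Quotient.map star (by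
    intro a a' ha
    have ha' : a - a' ∈ J := (Submodule.quotientRel_def J.toSubmodule).1 ha
    refine (Submodule.quotientRel_def J.toSubmodule).2 ?_
    rw [← star_sub]
    exact (star_mem ha' : star (a - a') ∈ J))

theorem mkₗ_mul (x y : B) : J.mkₗ (x * y) = J.mkₗ x * J.mkₗ y := rfl

theorem mkₗ_star (x : B) : J.mkₗ (star x) = star (J.mkₗ x) := rfl

theorem norm_mkₗ_sq_le (x : B) : ‖J.mkₗ x‖ * ‖J.mkₗ x‖ ≤ ‖J.mkₗ (star x * x)‖ := by
  refine le_of_forall_pos_le_add fun ε hε => ?_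
  obtain ⟨y, hy, hyn⟩ := J.exists_norm_lt (J.mkₗ (star x * x)) (half_pos hε)
  have hj : star x * x - y ∈ J := J.mkₗ_eq_iff.1 hy.symm
  obtain ⟨e, heJ, hs, he1, he⟩ := J.exists_approx hj (half_pos hε)
  have hes : star e = e := by obtain ⟨s, rfl⟩ := hs; simp
  have h1 : J.mkₗ x = J.mkₗ (x - x * e) := by
    rw [J.mkₗ_eq_iff]; simpa using J.mul_mem_left x heJ
  have hstar : ∀ z : B, ‖z - e * z‖ ≤ ‖z‖ := fun z => by
    have := norm_sub_mul_le hs he1 (star z)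
    rw [← norm_star, norm_star z] at this
    simpa [star_mul, hes] using this
  calc ‖J.mkₗ x‖ * ‖J.mkₗ x‖ ≤ ‖x - x * e‖ * ‖x - x * e‖ := by
        rw [h1]; gcongr <;> exact J.norm_mkₗ_le _
    _ = ‖star (x - x * e) * (x - x * e)‖ := CStarRing.norm_star_mul_self.symm
    _ = ‖(star x * x - star x * x * e) - e * (star x * x - star x * x * e)‖ := by
        congr 1
        simp only [star_sub, star_mul, hes]
        noncomm_ring
    _ ≤ ‖star x * x - star x * x * e‖ := hstar _
    _ = ‖(y - y * e) + ((star x * x - y) - (star x * x - y) * e)‖ := by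
        congr 1; noncomm_ring
    _ ≤ ‖y - y * e‖ + ‖(star x * x - y) - (star x * x - y) * e‖ := norm_add_le _ _
    _ ≤ ‖y‖ + ε / 2 := add_le_add (norm_sub_mul_le hs he1 y) he.le
    _ ≤ _ := by linarith

noncomputable instance : NonUnitalCStarAlgebra J.Quot where
  __ := (inferInstance : NormedAddCommGroup J.Quot)
  __ := (inferInstance : NormedSpace ℂ J.Quot)
  __ := (inferInstance : CompleteSpace J.Quot)
  mul := (· * ·)
  left_distrib a b c := by
    obtain ⟨a, rfl⟩ := J.mkₗ_surjective a
    obtain ⟨b, rfl⟩ := J.mkₗ_surjective b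
    obtain ⟨c, rfl⟩ := J.mkₗ_surjective c
    change J.mkₗ (a * (b + c)) = J.mkₗ (a * b + a * c)
    rw [mul_add]
  right_distrib a b c := by
    obtain ⟨a, rfl⟩ := J.mkₗ_surjective a
    obtain ⟨b, rfl⟩ := J.mkₗ_surjective b
    obtain ⟨c, rfl⟩ := J.mkₗ_surjective c
    change J.mkₗ ((a + b) * c) = J.mkₗ (a * c + b * c)
    rw [add_mul]
  zero_mul a := by
    obtain ⟨a, rfl⟩ := J.mkₗ_surjective a
    change J.mkₗ (0 * a) = J.mkₗ 0
    rw [zero_mul]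
  mul_zero a := by
    obtain ⟨a, rfl⟩ := J.mkₗ_surjective a
    change J.mkₗ (a * 0) = J.mkₗ 0
    rw [mul_zero]
  mul_assoc a b c := by
    obtain ⟨a, rfl⟩ := J.mkₗ_surjective a
    obtain ⟨b, rfl⟩ := J.mkₗ_surjective b
    obtain ⟨c, rfl⟩ := J.mkₗ_surjective c
    change J.mkₗ (a * b * c) = J.mkₗ (a * (b * c))
    rw [mul_assoc]
  norm_mul_le a b := by
    refine le_of_forall_pos_le_add fun ε hε => ?_
    have hc : Tendsto (fun δ : ℝ => (‖a‖ + δ) * (‖b‖ + δ)) (𝓝[>] 0) (𝓝 (‖a‖ * ‖b‖)) := by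
      have : Continuous fun δ : ℝ => (‖a‖ + δ) * (‖b‖ + δ) := by fun_prop
      simpa using (this.tendsto 0).mono_left nhdsWithin_le_nhds
    obtain ⟨δ, hδ, hδ0⟩ := ((hc.eventually_lt_const (show ‖a‖ * ‖b‖ < ‖a‖ * ‖b‖ + ε by
      linarith)).and self_mem_nhdsWithin).exists
    obtain ⟨x, rfl, hx⟩ := J.exists_norm_lt a hδ0
    obtain ⟨y, rfl, hy⟩ := J.exists_norm_lt b hδ0
    rw [← mkₗ_mul]
    calc ‖J.mkₗ (x * y)‖ ≤ ‖x‖ * ‖y‖ := (J.norm_mkₗ_le _).trans (norm_mul_le _ _)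
      _ ≤ (‖J.mkₗ x‖ + δ) * (‖J.mkₗ y‖ + δ) := by gcongr
      _ ≤ _ := hδ.le
  star_involutive a := by
    obtain ⟨a, rfl⟩ := J.mkₗ_surjective a
    rw [← mkₗ_star, ← mkₗ_star, star_star]
  star_mul a b := by
    obtain ⟨a, rfl⟩ := J.mkₗ_surjective a
    obtain ⟨b, rfl⟩ := J.mkₗ_surjective b
    change J.mkₗ (star (a * b)) = J.mkₗ (star b * star a)
    rw [star_mul]
  star_add a b := by
    obtain ⟨a, rfl⟩ := J.mkₗ_surjective a
    obtain ⟨b, rfl⟩ := J.mkₗ_surjective b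
    change J.mkₗ (star (a + b)) = J.mkₗ (star a + star b)
    rw [star_add]
  norm_mul_self_le a := by
    obtain ⟨a, rfl⟩ := J.mkₗ_surjective a
    exact J.norm_mkₗ_sq_le a
  smul_assoc c a b := by
    obtain ⟨a, rfl⟩ := J.mkₗ_surjective a
    obtain ⟨b, rfl⟩ := J.mkₗ_surjective b
    change J.mkₗ ((c • a) * b) = J.mkₗ (c • (a * b))
    rw [smul_mul_assoc]
  smul_comm c a b := by
    obtain ⟨a, rfl⟩ := J.mkₗ_surjective a
    obtain ⟨b, rfl⟩ := J.mkₗ_surjective b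
    change J.mkₗ (c • (a * b)) = J.mkₗ (a * (c • b))
    rw [mul_smul_comm]
  star_smul c a := by
    obtain ⟨a, rfl⟩ := J.mkₗ_surjective a
    change J.mkₗ (star (c • a)) = J.mkₗ (star c • star a)
    rw [star_smul]

/-- Quotient C*-algebras carry their usual order. -/
noncomputable instance : PartialOrder J.Quot := CStarAlgebra.spectralOrder J.Quot

instance : StarOrderedRing J.Quot := CStarAlgebra.spectralOrderedRing J.Quot

/-- The quotient map `B → B / J`. -/
noncomputable def quotMap : B →⋆ₙₐ[ℂ] J.Quot where
  toFun := J.mkₗ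
  map_smul' := J.mkₗ.map_smul
  map_zero' := J.mkₗ.map_zero
  map_add' := J.mkₗ.map_add
  map_mul' := J.mkₗ_mul
  map_star' := J.mkₗ_star

end Quot

end ClosedIdeal

end AperiodicInclusion

namespace AperiodicInclusion

open Filter Topology
open scoped MultiplierAlgebra

namespace ClosedIdeal

variable {A : Type*} [NonUnitalCStarAlgebra A]

instance : Bot (ClosedIdeal A) where
  bot :=
    { (⊥ : Submodule ℂ A) with
      mul_mem_left' := fun b x hx => by
        obtain rfl : x = 0 := hx
        simp
      mul_mem_right' := fun b x hx => by
        obtain rfl : x = 0 := hx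
        simp
      isClosed' := isClosed_singleton }

instance : Top (ClosedIdeal A) where
  top :=
    { (⊤ : Submodule ℂ A) with
      mul_mem_left' := fun _ _ _ => trivial
      mul_mem_right' := fun _ _ _ => trivial
      isClosed' := isClosed_univ }

instance : Min (ClosedIdeal A) where
  min I J :=
    { I.toSubmodule ⊓ J.toSubmodule with
      mul_mem_left' := fun b _ hx => ⟨I.mul_mem_left b hx.1, J.mul_mem_left b hx.2⟩
      mul_mem_right' := fun b _ hx => ⟨I.mul_mem_right b hx.1, J.mul_mem_right b hx.2⟩
      isClosed' := I.isClosed.inter J.isClosed }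

theorem mem_bot {x : A} : x ∈ (⊥ : ClosedIdeal A) ↔ x = 0 := Iff.rfl

theorem mem_top (x : A) : x ∈ (⊤ : ClosedIdeal A) := trivial

theorem mem_inf {I J : ClosedIdeal A} {x : A} : x ∈ I ⊓ J ↔ x ∈ I ∧ x ∈ J := Iff.rfl

theorem eq_bot_iff {I : ClosedIdeal A} : I = ⊥ ↔ ∀ x ∈ I, x = 0 :=
  ⟨fun h x hx => by rw [h] at hx; exact hx,
    fun h => SetLike.ext fun x => ⟨fun hx => h x hx, fun hx => by
      obtain rfl : x = 0 := hx
      exact zero_mem I⟩⟩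

/-- An ideal is essential if it meets every nonzero ideal nontrivially. -/
def IsEssential (I : ClosedIdeal A) : Prop :=
  ∀ J : ClosedIdeal A, J ≠ ⊥ → I ⊓ J ≠ ⊥

theorem isEssential_top : (⊤ : ClosedIdeal A).IsEssential := by
  intro J hJ h
  exact hJ (eq_bot_iff.2 fun x hx => eq_bot_iff.1 h x ⟨trivial, hx⟩)

theorem IsEssential.inf {I J : ClosedIdeal A} (hI : I.IsEssential) (hJ : J.IsEssential) :
    (I ⊓ J).IsEssential := by
  intro K hK h
  refine hI _ (hJ K hK) (eq_bot_iff.2 fun x hx => eq_bot_iff.1 h x ?_)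
  exact ⟨⟨hx.1, hx.2.1⟩, hx.2.2⟩

/-- An element that annihilates an essential ideal vanishes. -/
theorem IsEssential.eq_zero {I : ClosedIdeal A} (hI : I.IsEssential) {a : A}
    (ha : ∀ x ∈ I, a * x = 0) : a = 0 := by
  let K : ClosedIdeal A :=
    { carrier := {b | ∀ x ∈ I, b * x = 0}
      add_mem' := fun {b c} hb hc x hx => by rw [add_mul, hb x hx, hc x hx, add_zero]
      zero_mem' := fun x _ => zero_mul x
      smul_mem' := fun c b hb x hx => by rw [smul_mul_assoc, hb x hx, smul_zero]
      mul_mem_left' := fun b c hc x hx => by rw [mul_assoc, hc x hx, mul_zero]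
      mul_mem_right' := fun b c hc x hx => by
        rw [mul_assoc]
        exact hc _ (I.mul_mem_left b hx)
      isClosed' := by
        simp only [Set.ofPred_forall]
        exact isClosed_iInter fun x => isClosed_iInter fun _ =>
          isClosed_eq (by fun_prop) continuous_const }
  by_contra hne
  have hK : K ≠ ⊥ := fun h => hne (eq_bot_iff.1 h a ha)
  refine hI K hK (eq_bot_iff.2 fun x hx => ?_)
  exact CStarRing.mul_star_self_eq_zero_iff x |>.1 (hx.2 (star x) (star_mem hx.1))

section Multiplier

variable {I : ClosedIdeal A}

theorem coe_fst_mul (m : 𝓜(ℂ, I)) (x y : I) : m.fst (x * y) = m.fst x * y := by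
  have h : ∀ z : I, z * (m.fst (x * y) - m.fst x * y) = 0 := fun z => by
    rw [mul_sub, ← m.central, ← mul_assoc, ← mul_assoc, ← m.central, sub_self]
  have := h (star (m.fst (x * y) - m.fst x * y))
  rw [CStarRing.star_mul_self_eq_zero_iff] at this
  exact sub_eq_zero.1 this

/-- Multipliers of `I` map each closed ideal contained in `I` to itself. -/
theorem fst_mem {J : ClosedIdeal A} (h : J ≤ I) (m : 𝓜(ℂ, I)) {x : A} (hx : x ∈ J) :
    (m.fst ⟨x, h hx⟩ : A) ∈ J := by
  change (m.fst ⟨x, h hx⟩ : A) ∈ (J : Set A)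
  rw [← J.isClosed.closure_eq, Metric.mem_closure_iff]
  intro ε hε
  have hM : 0 < ‖m.fst‖ + 1 := by positivity
  obtain ⟨e, heJ, -, -, he⟩ := J.exists_approx hx (div_pos hε hM)
  refine ⟨m.fst ⟨x, h hx⟩ * e, J.mul_mem_left _ heJ, ?_⟩
  have h1 : (m.fst ⟨x, h hx⟩ : A) * e = (m.fst (⟨x, h hx⟩ * ⟨e, h heJ⟩) : I) := by
    rw [coe_fst_mul]; rfl
  have h2 : ‖(⟨x, h hx⟩ - ⟨x, h hx⟩ * ⟨e, h heJ⟩ : I)‖ < ε / (‖m.fst‖ + 1) := he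
  rw [h1, dist_eq_norm, ← AddSubgroupClass.coe_sub, ← map_sub]
  calc ‖m.fst (⟨x, h hx⟩ - ⟨x, h hx⟩ * ⟨e, h heJ⟩ : I)‖
      ≤ ‖m.fst‖ * ‖(⟨x, h hx⟩ - ⟨x, h hx⟩ * ⟨e, h heJ⟩ : I)‖ := m.fst.le_opNorm _
    _ ≤ (‖m.fst‖ + 1) * ‖(⟨x, h hx⟩ - ⟨x, h hx⟩ * ⟨e, h heJ⟩ : I)‖ := by gcongr; linarith
    _ < (‖m.fst‖ + 1) * (ε / (‖m.fst‖ + 1)) := by gcongr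
    _ = ε := mul_div_cancel₀ _ hM.ne'

theorem snd_mem {J : ClosedIdeal A} (h : J ≤ I) (m : 𝓜(ℂ, I)) {x : A} (hx : x ∈ J) :
    (m.snd ⟨x, h hx⟩ : A) ∈ J := by
  have h1 := fst_mem h (star m) (star_mem hx)
  rw [DoubleCentralizer.star_fst] at h1
  have h2 : star (⟨star x, h (star_mem hx)⟩ : I) = ⟨x, h hx⟩ := Subtype.ext (star_star x)
  rw [h2] at h1
  simpa using (star_mem h1 : star _ ∈ J)

/-- Restriction of a bounded linear operator on `I` that leaves `J ≤ I` invariant. -/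
noncomputable def restrictCLM {J : ClosedIdeal A} (h : J ≤ I) (T : I →L[ℂ] I)
    (hT : ∀ x (hx : x ∈ J), (T ⟨x, h hx⟩ : A) ∈ J) : J →L[ℂ] J :=
  LinearMap.mkContinuous
    { toFun := fun x => ⟨T ⟨x, h x.2⟩, hT x x.2⟩
      map_add' := fun x y => Subtype.ext (by
        have := congrArg (fun z : I => (z : A)) (T.map_add (⟨x, h x.2⟩ : I) (⟨y, h y.2⟩ : I))
        exact this)
      map_smul' := fun c x => Subtype.ext (by
        have := congrArg (fun z : I => (z : A)) (T.map_smul c (⟨x, h x.2⟩ : I))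
        exact this) } ‖T‖
    (fun x => T.le_opNorm ⟨x, h x.2⟩)

/-- Restriction of multipliers from `I` to an ideal `J` contained in `I`. -/
noncomputable def restrict {J : ClosedIdeal A} (h : J ≤ I) : 𝓜(ℂ, I) →⋆ₐ[ℂ] 𝓜(ℂ, J) where
  toFun m :=
    { fst := restrictCLM h m.fst fun _ hx => fst_mem h m hx
      snd := restrictCLM h m.snd fun _ hx => snd_mem h m hx
      central := fun x y => Subtype.ext (by
        have := congrArg (fun z : I => (z : A)) (m.central (⟨x, h x.2⟩ : I) (⟨y, h y.2⟩ : I))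
        exact this) }
  map_one' := rfl
  map_mul' _ _ := rfl
  map_zero' := rfl
  map_add' _ _ := rfl
  commutes' _ := rfl
  map_star' _ := rfl

theorem restrict_fst_coe {J : ClosedIdeal A} (h : J ≤ I) (m : 𝓜(ℂ, I)) (x : J) :
    ((restrict h m).fst x : A) = m.fst ⟨x, h x.2⟩ := rfl

theorem restrict_injective {J : ClosedIdeal A} (h : J ≤ I) (hJ : J.IsEssential) :
    Function.Injective (restrict h) := by
  rw [injective_iff_map_eq_zero]
  intro m hm
  have h0 : ∀ y : J, (m.fst ⟨y, h y.2⟩ : A) = 0 := fun y => by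
    rw [← restrict_fst_coe h, hm]; rfl
  have h1 : m.fst = 0 := by
    ext x
    refine hJ.eq_zero fun y hy => ?_
    have h2 := h0 ⟨x * y, J.mul_mem_left _ hy⟩
    have h3 := coe_fst_mul m x ⟨y, h hy⟩
    have h4 : (m.fst (x * ⟨y, h hy⟩) : A) = 0 := h2
    rw [h3] at h4
    exact h4
  rw [← norm_eq_zero, ← DoubleCentralizer.norm_fst, h1, norm_zero]

variable (I) in
/-- An element of `A` acts as a multiplier on the ideal `I` by left and right multiplication. -/
noncomputable def toMultiplier : A →⋆ₙₐ[ℂ] 𝓜(ℂ, I) where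
  toFun a :=
    { fst := LinearMap.mkContinuous
        { toFun := fun x => ⟨a * x, I.mul_mem_left a x.2⟩
          map_add' := fun x y => Subtype.ext (mul_add a (x : A) y)
          map_smul' := fun c x => Subtype.ext (mul_smul_comm c a (x : A)) } ‖a‖
        (fun x => norm_mul_le a (x : A))
      snd := LinearMap.mkContinuous
        { toFun := fun x => ⟨x * a, I.mul_mem_right a x.2⟩
          map_add' := fun x y => Subtype.ext (add_mul (x : A) y a)
          map_smul' := fun c x => Subtype.ext (smul_mul_assoc c (x : A) a) } ‖a‖
        (fun x => (norm_mul_le (x : A) a).trans_eq (mul_comm _ _))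
      central := fun x y => Subtype.ext (mul_assoc (x : A) a y) }
  map_smul' c a := by
    ext x
    · exact smul_mul_assoc c a (x : A)
    · exact mul_smul_comm c (x : A) a
  map_zero' := by
    ext x
    · exact zero_mul (x : A)
    · exact mul_zero (x : A)
  map_add' a b := by
    ext x
    · exact add_mul a b (x : A)
    · exact mul_add (x : A) a b
  map_mul' a b := by
    ext x
    · exact mul_assoc a b (x : A)
    · exact (mul_assoc (x : A) a b).symm
  map_star' a := by
    ext x
    · change star a * (x : A) = star (star (x : A) * a)
      simp
    · change (x : A) * star a = star (a * star (x : A))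
      simp

end Multiplier

end ClosedIdeal

section LocalMultiplier

variable (A : Type*) [NonUnitalCStarAlgebra A]

/-- The essential ideals of `A`, ordered by reverse inclusion. -/
structure EssentialIdeal where
  ideal : ClosedIdeal A
  isEssential : ideal.IsEssential

variable {A} in
instance : Preorder (EssentialIdeal A) where
  le I J := J.ideal ≤ I.ideal
  le_refl I := le_refl I.ideal
  le_trans _ _ _ h₁ h₂ := le_trans h₂ h₁

instance : Nonempty (EssentialIdeal A) := ⟨⟨⊤, ClosedIdeal.isEssential_top⟩⟩

instance : IsDirectedOrder (EssentialIdeal A) where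
  directed I J := ⟨⟨I.ideal ⊓ J.ideal, I.isEssential.inf J.isEssential⟩,
    fun _ hx => hx.1, fun _ hx => hx.2⟩

/-- The inductive system `I ↦ M(I)` of multiplier algebras of essential ideals. -/
noncomputable def transition (I J : EssentialIdeal A) (h : I ≤ J) :
    𝓜(ℂ, I.ideal) →⋆ₐ[ℂ] 𝓜(ℂ, J.ideal) :=
  ClosedIdeal.restrict h

theorem norm_transition (I J : EssentialIdeal A) (h : I ≤ J) (m : 𝓜(ℂ, I.ideal)) :
    ‖transition A I J h m‖ = ‖m‖ :=
  NonUnitalStarAlgHom.norm_map (transition A I J h)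
    (ClosedIdeal.restrict_injective _ J.isEssential) m

instance : DirectedSystem (fun I : EssentialIdeal A => 𝓜(ℂ, I.ideal))
    (fun I J h => transition A I J h) where
  map_self _ _ := rfl
  map_map _ _ _ _ _ _ := rfl

/-- The algebraic inductive limit of the multiplier algebras of the essential ideals. -/
def AlgLocalMultiplier : Type _ :=
  DirectLimit (fun I : EssentialIdeal A => 𝓜(ℂ, I.ideal)) (transition A)

namespace AlgLocalMultiplier

noncomputable instance : Ring (AlgLocalMultiplier A) :=
  inferInstanceAs (Ring (DirectLimit (fun I : EssentialIdeal A => 𝓜(ℂ, I.ideal)) (transition A)))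

noncomputable instance : Algebra ℂ (AlgLocalMultiplier A) :=
  inferInstanceAs (Algebra ℂ
    (DirectLimit (fun I : EssentialIdeal A => 𝓜(ℂ, I.ideal)) (transition A)))

variable {A}

/-- The canonical map from `M(I)` to the algebraic inductive limit. -/
noncomputable def of (I : EssentialIdeal A) (m : 𝓜(ℂ, I.ideal)) : AlgLocalMultiplier A := ⟦⟨I, m⟩⟧

theorem of_add (I : EssentialIdeal A) (m n : 𝓜(ℂ, I.ideal)) : of I (m + n) = of I m + of I n :=
  (DirectLimit.add_def (G := fun I : EssentialIdeal A => 𝓜(ℂ, I.ideal)) (f := transition A) I m n).symm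

theorem of_mul (I : EssentialIdeal A) (m n : 𝓜(ℂ, I.ideal)) : of I (m * n) = of I m * of I n :=
  (DirectLimit.mul_def (G := fun I : EssentialIdeal A => 𝓜(ℂ, I.ideal)) (f := transition A) I m n).symm

theorem of_zero (I : EssentialIdeal A) : of I 0 = 0 :=
  (DirectLimit.zero_def (f := transition A) I).symm

theorem of_one (I : EssentialIdeal A) : of I 1 = 1 :=
  (DirectLimit.one_def (f := transition A) I).symm

theorem of_smul (I : EssentialIdeal A) (c : ℂ) (m : 𝓜(ℂ, I.ideal)) : of I (c • m) = c • of I m :=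
  (DirectLimit.smul_def (G := fun I : EssentialIdeal A => 𝓜(ℂ, I.ideal)) (f := transition A) I m c).symm

theorem exists_of (x : AlgLocalMultiplier A) : ∃ I m, x = of I m :=
  DirectLimit.exists_eq_mk (f := transition A) x

theorem exists_of₂ (x y : AlgLocalMultiplier A) : ∃ I m n, x = of I m ∧ y = of I n :=
  DirectLimit.exists_eq_mk₂ (f := transition A) x y

noncomputable instance : Star (AlgLocalMultiplier A) :=
  inferInstanceAs (Star (DirectLimit (fun I : EssentialIdeal A => 𝓜(ℂ, I.ideal)) (transition A)))

theorem of_star (I : EssentialIdeal A) (m : 𝓜(ℂ, I.ideal)) : of I (star m) = star (of I m) := rfl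

noncomputable instance : StarRing (AlgLocalMultiplier A) where
  star_involutive x := by
    obtain ⟨I, m, rfl⟩ := exists_of x
    rw [← of_star, ← of_star, star_star]
  star_mul x y := by
    obtain ⟨I, m, n, rfl, rfl⟩ := exists_of₂ x y
    rw [← of_mul, ← of_star, ← of_star, ← of_star, ← of_mul, star_mul]
  star_add x y := by
    obtain ⟨I, m, n, rfl, rfl⟩ := exists_of₂ x y
    rw [← of_add, ← of_star, ← of_star, ← of_star, ← of_add, star_add]

/-- The norm of a local multiplier is its norm in any `M(I)` that it comes from. -/
noncomputable instance : Norm (AlgLocalMultiplier A) where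
  norm := DirectLimit.lift (transition A) (fun _ m => ‖m‖)
    (fun I J h m => (norm_transition A I J h m).symm)

theorem norm_of (I : EssentialIdeal A) (m : 𝓜(ℂ, I.ideal)) : ‖of I m‖ = ‖m‖ := rfl

theorem normCore : NormedSpace.Core ℂ (AlgLocalMultiplier A) where
  norm_nonneg x := by
    obtain ⟨I, m, rfl⟩ := exists_of x
    exact norm_nonneg m
  norm_smul c x := by
    obtain ⟨I, m, rfl⟩ := exists_of x
    rw [← of_smul, norm_of, norm_of, norm_smul]
  norm_triangle x y := by
    obtain ⟨I, m, n, rfl, rfl⟩ := exists_of₂ x y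
    rw [← of_add, norm_of, norm_of, norm_of]
    exact norm_add_le m n
  norm_eq_zero_iff x := by
    obtain ⟨I, m, rfl⟩ := exists_of x
    refine ⟨fun h => ?_, fun h => ?_⟩
    · rw [norm_of, norm_eq_zero] at h
      rw [h, of_zero]
    · rw [h, ← of_zero I, norm_of, norm_zero]

noncomputable instance : NormedRing (AlgLocalMultiplier A) where
  __ := (inferInstance : Ring (AlgLocalMultiplier A))
  __ := NormedAddCommGroup.ofCore (normCore (A := A))
  norm_mul_le x y := by
    obtain ⟨I, m, n, rfl, rfl⟩ := exists_of₂ x y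
    rw [← of_mul, norm_of, norm_of, norm_of]
    exact norm_mul_le m n

noncomputable instance : NormedAlgebra ℂ (AlgLocalMultiplier A) where
  norm_smul_le c x := ((normCore (A := A)).norm_smul c x).le

instance : StarModule ℂ (AlgLocalMultiplier A) where
  star_smul c x := by
    obtain ⟨I, m, rfl⟩ := exists_of x
    rw [← of_smul, ← of_star, ← of_star, ← of_smul, star_smul]

instance : CStarRing (AlgLocalMultiplier A) where
  norm_mul_self_le x := by
    obtain ⟨I, m, rfl⟩ := exists_of x
    rw [← of_star, ← of_mul, norm_of, norm_of]
    exact CStarRing.norm_mul_self_le m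

end AlgLocalMultiplier

/-- The local multiplier algebra `M_loc(A)`: the C*-algebraic inductive limit of the multiplier
algebras of the essential ideals of `A`, that is, the completion of the algebraic one. -/
def LocalMultiplierAlgebra : Type _ := UniformSpace.Completion (AlgLocalMultiplier A)

namespace LocalMultiplierAlgebra

open UniformSpace

noncomputable instance : NormedRing (LocalMultiplierAlgebra A) :=
  inferInstanceAs (NormedRing (Completion (AlgLocalMultiplier A)))

instance : CompleteSpace (LocalMultiplierAlgebra A) :=
  inferInstanceAs (CompleteSpace (Completion (AlgLocalMultiplier A)))

variable {A}

/-- The inclusion of the algebraic inductive limit into its completion. -/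
noncomputable def inclRingHom : AlgLocalMultiplier A →+* LocalMultiplierAlgebra A :=
  (Completion.coeRingHom : AlgLocalMultiplier A →+* Completion (AlgLocalMultiplier A))

noncomputable instance : NormedSpace ℂ (LocalMultiplierAlgebra A) :=
  inferInstanceAs (NormedSpace ℂ (Completion (AlgLocalMultiplier A)))

theorem inclRingHom_smul (c : ℂ) (x : AlgLocalMultiplier A) :
    inclRingHom (c • x) = c • inclRingHom x :=
  Completion.coe_smul c x

theorem norm_inclRingHom (x : AlgLocalMultiplier A) : ‖inclRingHom x‖ = ‖x‖ :=
  Completion.norm_coe x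

theorem denseRange_inclRingHom : DenseRange (inclRingHom (A := A)) := Completion.denseRange_coe

noncomputable instance : Algebra ℂ (LocalMultiplierAlgebra A) :=
  Algebra.ofModule
    (fun c x y => by
      refine denseRange_inclRingHom.induction_on₂ (p := fun x y => c • x * y = c • (x * y))
        (isClosed_eq ((continuous_fst.const_smul c).mul continuous_snd) ((continuous_fst.mul continuous_snd).const_smul c)) (fun a b => ?_) x y
      rw [← map_mul, ← inclRingHom_smul, ← map_mul, ← inclRingHom_smul, smul_mul_assoc])
    (fun c x y => by
      refine denseRange_inclRingHom.induction_on₂ (p := fun x y => x * c • y = c • (x * y))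
        (isClosed_eq (continuous_fst.mul (continuous_snd.const_smul c)) ((continuous_fst.mul continuous_snd).const_smul c)) (fun a b => ?_) x y
      rw [← map_mul, ← inclRingHom_smul, ← map_mul, ← inclRingHom_smul, mul_smul_comm])

noncomputable instance : NormedAlgebra ℂ (LocalMultiplierAlgebra A) where
  norm_smul_le := norm_smul_le

/-- The inclusion of the algebraic inductive limit into its completion, as a `ℂ`-linear map. -/
noncomputable def incl : AlgLocalMultiplier A →ₐ[ℂ] LocalMultiplierAlgebra A :=
  AlgHom.ofLinearMap
    { toFun := inclRingHom
      map_add' := map_add inclRingHom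
      map_smul' := inclRingHom_smul } (map_one inclRingHom) (map_mul inclRingHom)

theorem norm_incl (x : AlgLocalMultiplier A) : ‖incl x‖ = ‖x‖ := norm_inclRingHom x

theorem denseRange_incl : DenseRange (incl (A := A)) := denseRange_inclRingHom

noncomputable instance : Star (LocalMultiplierAlgebra A) where
  star := (Completion.map star :
    Completion (AlgLocalMultiplier A) → Completion (AlgLocalMultiplier A))

theorem continuous_star' : Continuous (star : LocalMultiplierAlgebra A → _) :=
  Completion.continuous_map

theorem incl_star (x : AlgLocalMultiplier A) : incl (star x) = star (incl x) :=
  (Completion.map_coe (star_isometry (E := AlgLocalMultiplier A)).uniformContinuous x).symm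

noncomputable instance : StarRing (LocalMultiplierAlgebra A) where
  star_involutive x := by
    refine denseRange_incl.induction_on (p := fun x => star (star x) = x) x
      (isClosed_eq (continuous_star'.comp continuous_star') continuous_id) fun a => ?_
    rw [← incl_star, ← incl_star, star_star]
  star_mul x y := by
    refine denseRange_incl.induction_on₂ (p := fun x y => star (x * y) = star y * star x)
      (isClosed_eq (continuous_star'.comp continuous_mul)
        ((continuous_star'.comp continuous_snd).mul (continuous_star'.comp continuous_fst)))
      (fun a b => ?_) x y
    rw [← map_mul, ← incl_star, ← incl_star, ← incl_star, ← map_mul, star_mul]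
  star_add x y := by
    refine denseRange_incl.induction_on₂ (p := fun x y => star (x + y) = star x + star y)
      (isClosed_eq (continuous_star'.comp continuous_add)
        ((continuous_star'.comp continuous_fst).add (continuous_star'.comp continuous_snd)))
      (fun a b => ?_) x y
    rw [← map_add, ← incl_star, ← incl_star, ← incl_star, ← map_add, star_add]

noncomputable instance : CStarAlgebra (LocalMultiplierAlgebra A) where
  star_smul c x := by
    refine denseRange_incl.induction_on (p := fun x => star (c • x) = star c • star x) x
      (isClosed_eq (continuous_star'.comp (continuous_const_smul c))
        (continuous_star'.const_smul (star c))) fun a => ?_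
    rw [← map_smul, ← incl_star, ← incl_star, ← map_smul, star_smul]
  norm_mul_self_le x := by
    refine denseRange_incl.induction_on (p := fun x => ‖x‖ * ‖x‖ ≤ ‖star x * x‖) x
      (isClosed_le (continuous_norm.mul continuous_norm)
        (continuous_norm.comp (continuous_star'.mul continuous_id))) fun a => ?_
    rw [← incl_star, ← map_mul, norm_incl, norm_incl]
    exact CStarRing.norm_mul_self_le a

variable (A) in
/-- The canonical embedding `A → M(A) → M_loc(A)`. -/
noncomputable def embedding : A →⋆ₙₐ[ℂ] LocalMultiplierAlgebra A where
  toFun a := incl (AlgLocalMultiplier.of ⟨⊤, ClosedIdeal.isEssential_top⟩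
    (ClosedIdeal.toMultiplier ⊤ a))
  map_smul' c a := by
    rw [map_smul, AlgLocalMultiplier.of_smul, map_smul]; rfl
  map_zero' := by
    rw [map_zero, AlgLocalMultiplier.of_zero, map_zero]
  map_add' a b := by
    rw [map_add, AlgLocalMultiplier.of_add, map_add]
  map_mul' a b := by
    rw [map_mul, AlgLocalMultiplier.of_mul, map_mul]
  map_star' a := by
    rw [map_star, AlgLocalMultiplier.of_star, incl_star]

/-- The canonical embedding is injective. -/
theorem embedding_injective : Function.Injective (embedding A) := by
  rw [injective_iff_map_eq_zero]
  intro a ha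
  have h1 : ‖ClosedIdeal.toMultiplier (⊤ : ClosedIdeal A) a‖ = 0 := by
    have h2 : ‖embedding A a‖ = 0 := by rw [ha, norm_zero]
    exact (norm_incl _).symm.trans h2
  rw [norm_eq_zero] at h1
  refine ClosedIdeal.isEssential_top.eq_zero fun x hx => ?_
  have h3 := congrArg (fun m : 𝓜(ℂ, (⊤ : ClosedIdeal A)) => (m.fst ⟨x, hx⟩ : A)) h1
  exact h3

end LocalMultiplierAlgebra

end LocalMultiplier

end AperiodicInclusion

namespace AperiodicInclusion

open Filter Topology
open scoped CStarAlgebra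

section Image

variable {B C : Type*} [NonUnitalCStarAlgebra B] [NonUnitalCStarAlgebra C] (π : B →⋆ₙₐ[ℂ] C)

theorem continuous_starHom : Continuous π :=
  AddMonoidHomClass.continuous_of_bound π 1 fun x => by
    rw [one_mul]; exact NonUnitalStarAlgHom.norm_apply_le π x

/-- The kernel of a `*`-homomorphism. -/
def kerIdeal : ClosedIdeal B where
  carrier := {b | π b = 0}
  add_mem' {x y} hx hy := by
    change π (x + y) = 0
    rw [map_add, show π x = 0 from hx, show π y = 0 from hy, add_zero]
  zero_mem' := map_zero π
  smul_mem' c x hx := by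
    change π (c • x) = 0
    rw [map_smul, show π x = 0 from hx, smul_zero]
  mul_mem_left' b x hx := by
    change π (b * x) = 0
    rw [map_mul, show π x = 0 from hx, mul_zero]
  mul_mem_right' b x hx := by
    change π (x * b) = 0
    rw [map_mul, show π x = 0 from hx, zero_mul]
  isClosed' := isClosed_eq (continuous_starHom π) continuous_const

/-- The injective `*`-homomorphism on `B / ker π` induced by `π`. -/
noncomputable def kerLift : (kerIdeal π).Quot →⋆ₙₐ[ℂ] C :=
  let f : (kerIdeal π).Quot →ₗ[ℂ] C :=
    (kerIdeal π).toSubmodule.liftQ ((π : B →ₙₐ[ℂ] C) : B →ₗ[ℂ] C) (fun _ hx => hx)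
  have hf : ∀ b, f ((kerIdeal π).mkₗ b) = π b := fun _ => rfl
  { toFun := f
    map_smul' := f.map_smul
    map_zero' := f.map_zero
    map_add' := f.map_add
    map_mul' := fun x y => by
      obtain ⟨x, rfl⟩ := (kerIdeal π).mkₗ_surjective x
      obtain ⟨y, rfl⟩ := (kerIdeal π).mkₗ_surjective y
      rw [← ClosedIdeal.mkₗ_mul, hf, hf, hf, map_mul]
    map_star' := fun x => by
      obtain ⟨x, rfl⟩ := (kerIdeal π).mkₗ_surjective x
      rw [← ClosedIdeal.mkₗ_star, hf, hf, map_star] }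

theorem kerLift_mk (b : B) : kerLift π ((kerIdeal π).mkₗ b) = π b := rfl

theorem kerLift_injective : Function.Injective (kerLift π) := by
  rw [injective_iff_map_eq_zero]
  intro x hx
  obtain ⟨x, rfl⟩ := (kerIdeal π).mkₗ_surjective x
  rw [kerLift_mk] at hx
  rw [← (kerIdeal π).mkₗ.map_zero, ClosedIdeal.mkₗ_eq_iff, sub_zero]
  exact hx

/-- The image of a `*`-homomorphism between C*-algebras is closed. -/
instance isClosed_range :
    IsClosed ((NonUnitalStarAlgHom.range π : NonUnitalStarSubalgebra ℂ C) : Set C) := by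
  have h : Set.range π = Set.range (kerLift π) := by
    ext y
    constructor
    · rintro ⟨x, rfl⟩
      exact ⟨(kerIdeal π).mkₗ x, rfl⟩
    · rintro ⟨x, rfl⟩
      obtain ⟨x, rfl⟩ := (kerIdeal π).mkₗ_surjective x
      exact ⟨x, rfl⟩
  rw [NonUnitalStarAlgHom.coe_range, h]
  exact (NonUnitalStarAlgHom.isometry (kerLift π)
    (kerLift_injective π)).isClosedEmbedding.isClosed_range

/-- The image `π(B)` of a `*`-homomorphism, as a C*-algebra. -/
def Image : Type _ := (NonUnitalStarAlgHom.range π : NonUnitalStarSubalgebra ℂ C)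

noncomputable instance : NonUnitalCStarAlgebra (Image π) :=
  inferInstanceAs
    (NonUnitalCStarAlgebra (NonUnitalStarAlgHom.range π : NonUnitalStarSubalgebra ℂ C))

noncomputable instance : PartialOrder (Image π) := CStarAlgebra.spectralOrder (Image π)

instance : StarOrderedRing (Image π) := CStarAlgebra.spectralOrderedRing (Image π)

/-- `π` regarded as a `*`-homomorphism onto its image. -/
def toImage : B →⋆ₙₐ[ℂ] Image π := NonUnitalStarAlgHom.rangeRestrict π

end Image

namespace ClosedIdeal

variable {B : Type*} [NonUnitalCStarAlgebra B]

/-- The closed linear span of a family of closed ideals. -/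
def closedSpan (S : Set (ClosedIdeal B)) : ClosedIdeal B where
  toSubmodule := (Submodule.span ℂ {x : B | ∃ J ∈ S, x ∈ J}).topologicalClosure
  mul_mem_left' b x hx := by
    refine map_mem_closure (continuous_const_mul b) hx fun y hy => ?_
    refine Submodule.span_induction (p := fun z _ => b * z ∈ Submodule.span ℂ _) ?_ ?_ ?_ ?_ hy
    · rintro z ⟨J, hJ, hz⟩
      exact Submodule.subset_span ⟨J, hJ, J.mul_mem_left b hz⟩
    · rw [mul_zero]; exact zero_mem _
    · intro z w _ _ hz hw
      rw [mul_add]; exact add_mem hz hw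
    · intro c z _ hz
      rw [mul_smul_comm]; exact Submodule.smul_mem _ c hz
  mul_mem_right' b x hx := by
    refine map_mem_closure (f := fun z => z * b) (continuous_mul_const b) hx fun y hy => ?_
    refine Submodule.span_induction (p := fun z _ => z * b ∈ Submodule.span ℂ _) ?_ ?_ ?_ ?_ hy
    · rintro z ⟨J, hJ, hz⟩
      exact Submodule.subset_span ⟨J, hJ, J.mul_mem_right b hz⟩
    · rw [zero_mul]; exact zero_mem _
    · intro z w _ _ hz hw
      rw [add_mul]; exact add_mem hz hw
    · intro c z _ hz
      rw [smul_mul_assoc]; exact Submodule.smul_mem _ c hz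
  isClosed' := Submodule.isClosed_topologicalClosure _

end ClosedIdeal

section Notions

variable {A B A' : Type*} [NonUnitalCStarAlgebra A] [NonUnitalCStarAlgebra B]
  [NonUnitalCStarAlgebra A']

/-- Hereditary C*-subalgebras. -/
def IsHereditary [PartialOrder A] (D : NonUnitalStarSubalgebra ℂ A) : Prop :=
  IsClosed (D : Set A) ∧ ∀ a d : A, 0 ≤ a → a ≤ d → d ∈ D → a ∈ D

/-- The C*-inclusion `ι : A → B` is aperiodic: every element of the normed `A`-bimodule `B / A`,
with the quotient norm, satisfies Kishimoto's condition. -/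
def IsAperiodic [PartialOrder A] (ι : A →⋆ₙₐ[ℂ] B) : Prop :=
  ∀ (b : B) (D : NonUnitalStarSubalgebra ℂ A), IsHereditary D → D ≠ ⊥ → ∀ ε : ℝ, 0 < ε →
    ∃ a ∈ D, 0 ≤ a ∧ ‖a‖ = 1 ∧
      ‖(Submodule.Quotient.mk (ι a * b * ι a) :
        B ⧸ LinearMap.range ((ι : A →ₙₐ[ℂ] B) : A →ₗ[ℂ] B))‖ < ε

/-- A generalised expectation for the C*-inclusion `ι : A → B`, with values in the C*-algebra `A'`
that contains `A` through `j`: a completely positive contraction that is the identity on `A`. -/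
structure GeneralisedExpectation [PartialOrder B] [StarOrderedRing B] [PartialOrder A']
    [StarOrderedRing A'] (ι : A →⋆ₙₐ[ℂ] B) (j : A →⋆ₙₐ[ℂ] A') extends B →CP A' where
  norm_map_le : ∀ b : B, ‖toLinearMap b‖ ≤ ‖b‖
  map_incl : ∀ a : A, toLinearMap (ι a) = j a

namespace GeneralisedExpectation

variable [PartialOrder B] [StarOrderedRing B] [PartialOrder A'] [StarOrderedRing A']
  {ι : A →⋆ₙₐ[ℂ] B} {j : A →⋆ₙₐ[ℂ] A'}

instance : CoeFun (GeneralisedExpectation ι j) (fun _ => B → A') where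
  coe E := E.toCompletelyPositiveMap

/-- The ideal `𝒩_E`: the closed linear span of all closed ideals contained in `ker E`. -/
def nullIdeal (E : GeneralisedExpectation ι j) : ClosedIdeal B :=
  ClosedIdeal.closedSpan {J | ∀ x ∈ J, E x = 0}

/-- `E` is almost faithful. -/
def IsAlmostFaithful (E : GeneralisedExpectation ι j) : Prop :=
  ∀ b : B, (∀ c : B, E (star (b * c) * (b * c)) = 0) → b = 0

/-- `E` is supportive. -/
def IsSupportive [PartialOrder A] (E : GeneralisedExpectation ι j) : Prop :=
  ∀ b : B, 0 ≤ b → E b ≠ 0 → ∃ δ : ℝ, 0 < δ ∧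
    ∃ D : NonUnitalStarSubalgebra ℂ A, IsHereditary D ∧ D ≠ ⊥ ∧
      ∀ x ∈ D, 0 ≤ x → ‖x‖ = 1 → δ ≤ ‖j x * E b * j x‖

/-- `E` is an essentially defined conditional expectation, that is, it takes values in `M_loc(A)`:
its codomain is identified, compatibly with the inclusions of `A`, with a C*-subalgebra of
`M_loc(A)` (such as `M_loc(A)` itself, or `A` for a genuine conditional expectation). -/
def IsEssentiallyDefined (_E : GeneralisedExpectation ι j) : Prop :=
  ∃ Φ : A' →⋆ₙₐ[ℂ] LocalMultiplierAlgebra A, Function.Injective Φ ∧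
    ∀ a : A, Φ (j a) = LocalMultiplierAlgebra.embedding A a

end GeneralisedExpectation

/-- Cuntz subequivalence `a ≾ b` for positive elements. -/
def CuntzBelow (a b : B) : Prop :=
  ∀ ε : ℝ, 0 < ε → ∃ x : B, ‖a - star x * b * x‖ < ε

/-- `A⁺` supports `B`. -/
def Supports [PartialOrder A] [PartialOrder B] (ι : A →⋆ₙₐ[ℂ] B) : Prop :=
  ∀ b : B, 0 ≤ b → b ≠ 0 → ∃ a : A, 0 ≤ a ∧ a ≠ 0 ∧ CuntzBelow (ι a) b

/-- The condition `J ∩ A = 0`. -/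
def MeetsTrivially (ι : A →⋆ₙₐ[ℂ] B) (J : ClosedIdeal B) : Prop :=
  ∀ a : A, ι a ∈ J → ι a = 0

/-- `A` detects ideals in `B`: `J ∩ A ≠ 0` for every nonzero closed ideal `J`. -/
def DetectsIdeals (ι : A →⋆ₙₐ[ℂ] B) : Prop :=
  ∀ J : ClosedIdeal B, J ≠ ⊥ → ¬ MeetsTrivially ι J

/-- `N` is the hidden ideal: the unique maximal closed ideal with `N ∩ A = 0`. -/
def IsHiddenIdeal (ι : A →⋆ₙₐ[ℂ] B) (N : ClosedIdeal B) : Prop :=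
  Maximal (MeetsTrivially ι) N ∧ ∀ N' : ClosedIdeal B, Maximal (MeetsTrivially ι) N' → N' = N

/-- `A` is `B`-minimal: the closed linear span of `B I B` is `B` for each nonzero closed ideal `I`
of `A`. -/
def IsMinimal (ι : A →⋆ₙₐ[ℂ] B) : Prop :=
  ∀ I : ClosedIdeal A, I ≠ ⊥ →
    closure (Submodule.span ℂ {z : B | ∃ x y : B, ∃ i ∈ I, z = x * ι i * y} : Set B) = Set.univ

variable (B) in
/-- `B` is a simple C*-algebra. -/
def IsSimple : Prop :=
  Nontrivial B ∧ ∀ J : ClosedIdeal B, J = ⊥ ∨ J = ⊤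

/-- An infinite element of `B⁺ \ {0}`. -/
def IsInfinite [PartialOrder B] (a : B) : Prop :=
  0 ≤ a ∧ a ≠ 0 ∧ ∃ b : B, 0 ≤ b ∧ b ≠ 0 ∧ ∀ ε : ℝ, 0 < ε →
    ∃ x ∈ Set.range (a * ·), ∃ y ∈ Set.range (a * ·),
      ‖star x * x - a‖ < ε ∧ ‖star y * y - b‖ < ε ∧ ‖star x * y‖ < ε

variable (B) in
/-- `B` is purely infinite (in the sense of Kirchberg and Rørdam): it has no characters, and
`a ≾ b` whenever `a, b` are positive and `a` is in the closed ideal generated by `b`. -/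
def IsPurelyInfinite [PartialOrder B] : Prop :=
  (∀ χ : B →⋆ₙₐ[ℂ] ℂ, χ = 0) ∧
    ∀ a b : B, 0 ≤ a → 0 ≤ b → (∀ J : ClosedIdeal B, b ∈ J → a ∈ J) → CuntzBelow a b

end Notions

end AperiodicInclusion

/-!
The heart of the matter is that a positive `b` with `E b ≠ 0` dominates, in the Cuntz preorder, a
nonzero positive element of `A`. Supportivity gives a hereditary subalgebra `D` on which `E b` is
bounded below by some `δ`, and aperiodicity gives `a ∈ D` of norm one for which `a b a` is close to
an element `a'` of `A`. Since `E` is a contraction and an `A`-bimodule map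
(`map_star_mul_of_eq`, from the Kadison–Schwarz inequality), `a'` is close to `a E(b) a` and hence
not small, and then `a b a` dominates a nonzero element of `A`
(`exists_cuntzBelow_of_norm_sub_le`).

An element lies in `𝒩_E` exactly when `E` vanishes on the ideal it generates (`mem_nullIdeal_iff`),
so by polarisation every positive `b ∉ 𝒩_E` has a conjugate `x* b x` with nonzero expectation; thus `b`
dominates a nonzero element of `A` as well. An ideal contains everything dominated by one of its
elements, so an ideal not contained in `𝒩_E` meets `A`; this gives the statements on ideals,
quotients and simplicity.

A positive element of `M_loc(A)` is close to a positive multiplier `μ` of an essential ideal, and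
the elements of `A` orthogonal to `(μ - t)₋` form a nonzero hereditary subalgebra on which `μ ≥ t`. So
essentially defined conditional expectations are supportive.

If `B` is simple and `a` is infinite, then `a B` contains approximately orthogonal copies of a fixed
nonzero element (`exists_orthogonal_copies`), finitely many of which dominate any given
positive element, so `a` dominates everything. Conversely, pure infiniteness finds
two copies of `a` below orthogonal elements of `a B a`; these exist unless the corner is spanned by
a minimal projection `p`, and then either `B = ℂ p` has a character, or `p` would dominate `p + h` for
some nonzero `h` orthogonal to `p` (`not_cuntzBelow_add_of_orthogonal`).
-/

namespace AperiodicInclusion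

open Filter Topology
open scoped CStarAlgebra

/-! ### Cuntz comparison -/

section Cuntz

variable {A B : Type*} [NonUnitalCStarAlgebra A] [NonUnitalCStarAlgebra B]

theorem cuntzBelow_of_approx {a b : B}
    (h : ∀ ε : ℝ, 0 < ε → ∃ c : B, CuntzBelow c b ∧ ‖a - c‖ < ε) : CuntzBelow a b := by
  intro ε hε
  obtain ⟨c, hc, hac⟩ := h (ε / 2) (half_pos hε)
  obtain ⟨x, hx⟩ := hc (ε / 2) (half_pos hε)
  refine ⟨x, ?_⟩
  calc ‖a - star x * b * x‖ = ‖(a - c) + (c - star x * b * x)‖ := by congr 1; abel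
    _ ≤ ‖a - c‖ + ‖c - star x * b * x‖ := norm_add_le _ _
    _ < ε := by linarith

theorem cuntzBelow_zero (b : B) : CuntzBelow 0 b :=
  fun ε hε => ⟨0, by simpa using hε⟩

theorem cuntzBelow_conjugate (b x : B) : CuntzBelow (star x * b * x) b :=
  fun ε hε => ⟨x, by simpa using hε⟩

theorem norm_conjugate_le (x b : B) : ‖star x * b * x‖ ≤ ‖b‖ * ‖x‖ ^ 2 := by
  calc ‖star x * b * x‖ ≤ ‖star x‖ * ‖b‖ * ‖x‖ :=
        (norm_mul_le _ _).trans (by gcongr; exact norm_mul_le _ _)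
    _ = _ := by rw [norm_star]; ring

theorem CuntzBelow.conjugate {b c : B} (h : CuntzBelow b c) (x : B) :
    CuntzBelow (star x * b * x) c := by
  intro ε hε
  obtain ⟨y, hy⟩ := h (ε / (‖x‖ ^ 2 + 1)) (by positivity)
  refine ⟨y * x, ?_⟩
  have : star x * b * x - star (y * x) * c * (y * x) = star x * (b - star y * c * y) * x := by
    rw [star_mul]; noncomm_ring
  rw [this]
  calc _ ≤ ‖b - star y * c * y‖ * ‖x‖ ^ 2 := norm_conjugate_le _ _
    _ ≤ ‖b - star y * c * y‖ * (‖x‖ ^ 2 + 1) := by gcongr; linarith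
    _ < ε / (‖x‖ ^ 2 + 1) * (‖x‖ ^ 2 + 1) := by gcongr
    _ = ε := by field_simp

theorem CuntzBelow.trans {a b c : B} (hab : CuntzBelow a b) (hbc : CuntzBelow b c) :
    CuntzBelow a c := by
  refine cuntzBelow_of_approx fun ε hε => ?_
  obtain ⟨x, hx⟩ := hab ε hε
  exact ⟨_, hbc.conjugate x, hx⟩

theorem CuntzBelow.map {a b : A} (h : CuntzBelow a b) (π : A →⋆ₙₐ[ℂ] B) :
    CuntzBelow (π a) (π b) := by
  intro ε hε
  obtain ⟨x, hx⟩ := h ε hε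
  refine ⟨π x, ?_⟩
  rw [← map_star, ← map_mul, ← map_mul, ← map_sub]
  exact (NonUnitalStarAlgHom.norm_apply_le π _).trans_lt hx

/-- A closed ideal contains everything that is Cuntz below one of its elements. -/
theorem CuntzBelow.mem {a b : B} (h : CuntzBelow a b) {J : ClosedIdeal B} (hb : b ∈ J) :
    a ∈ J := by
  change a ∈ (J : Set B)
  rw [← J.isClosed.closure_eq, Metric.mem_closure_iff]
  intro ε hε
  obtain ⟨x, hx⟩ := h ε hε
  exact ⟨_, J.mul_mem_right _ (J.mul_mem_left _ hb), by rwa [dist_eq_norm]⟩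

theorem norm_cube_of_isSelfAdjoint {a : B} (ha : IsSelfAdjoint a) :
    ‖a * a * a‖ = ‖a‖ ^ 3 := by
  refine le_antisymm ?_ ?_
  · calc ‖a * a * a‖ ≤ ‖a‖ * ‖a‖ * ‖a‖ := (norm_mul_le _ _).trans (by gcongr; exact norm_mul_le _ _)
      _ = _ := by ring
  · rcases eq_or_ne a 0 with rfl | h
    · simp
    have h2 : ‖a * a‖ = ‖a‖ * ‖a‖ := by
      have := CStarRing.norm_star_mul_self (x := a)
      rwa [ha.star_eq] at this
    have h4 : ‖a * a * (a * a)‖ = ‖a * a‖ * ‖a * a‖ := by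
      have := CStarRing.norm_star_mul_self (x := a * a)
      rwa [star_mul, ha.star_eq] at this
    have hpos : 0 < ‖a‖ := norm_pos_iff.2 h
    refine le_of_mul_le_mul_right ?_ hpos
    calc ‖a‖ ^ 3 * ‖a‖ = ‖a * a * (a * a)‖ := by rw [h4, h2]; ring
      _ = ‖a * a * a * a‖ := by rw [mul_assoc (a * a)]
      _ ≤ _ := norm_mul_le _ _

variable [PartialOrder B] [StarOrderedRing B]

/-- The scalar estimate behind the approximate unit `(d / (d + η))²` of a positive element `d`. -/
theorem abs_local_unit_error_le {t η : ℝ} (ht : 0 ≤ t) (hη : 0 < η) :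
    |t - (t / (t + η)) ^ 2 * t - t * (t / (t + η)) ^ 2
      + (t / (t + η)) ^ 2 * t * (t / (t + η)) ^ 2| ≤ 2 * η := by
  have hw0 : 0 ≤ t / (t + η) := by positivity
  have hw1 : t / (t + η) ≤ 1 := by rw [div_le_one (by positivity)]; linarith
  have htw : t * (1 - t / (t + η)) = η * (t / (t + η)) := by field_simp; ring
  generalize t / (t + η) = w at *
  have h0 : t - w ^ 2 * t - t * w ^ 2 + w ^ 2 * t * w ^ 2 = η * (w * ((1 + w) * (1 - w ^ 2))) := by
    linear_combination (1 + w) * (1 - w ^ 2) * htw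
  have h1 : 0 ≤ 1 - w ^ 2 := by nlinarith
  have h2 : 0 ≤ w * ((1 + w) * (1 - w ^ 2)) := mul_nonneg hw0 (mul_nonneg (by linarith) h1)
  have h3 : (1 + w) * (1 - w ^ 2) ≤ 2 * 1 :=
    mul_le_mul (by linarith) (by linarith [sq_nonneg w]) h1 (by norm_num)
  have h4 : w * ((1 + w) * (1 - w ^ 2)) ≤ 1 * (2 * 1) :=
    mul_le_mul hw1 h3 (mul_nonneg (by linarith) h1) (by norm_num)
  rw [h0, abs_of_nonneg (mul_nonneg hη.le h2)]
  linarith [mul_le_mul_of_nonneg_left h4 hη.le]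

/-- A positive `d` has an approximate unit of the form `e = s d s`: the norm of
`(1 - e) d (1 - e)` is as small as desired. -/
theorem exists_isSelfAdjoint_norm_le {d : B} (hd : 0 ≤ d) {η : ℝ} (hη : 0 < η) :
    ∃ s : B, IsSelfAdjoint s ∧
      ‖d - s * d * s * d - d * (s * d * s) + s * d * s * d * (s * d * s)‖ ≤ 2 * η := by
  -- on the spectrum, `t k(t)² = (t / (t + η))²`; the absolute value makes `k` continuous on `ℝ`
  set k : ℝ → ℝ := fun t => √t / (|t| + η) with hk
  have hkc : Continuous k := by
    refine Continuous.div (by fun_prop) (by fun_prop) fun t => ?_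
    positivity
  have hk0 : k 0 = 0 := by simp [hk]
  refine ⟨cfcₙ k d, cfcₙ_predicate k d, ?_⟩
  set g : ℝ → ℝ := fun t => k t * t * k t with hg
  have hgc : Continuous g := by fun_prop
  have hg0 : g 0 = 0 := by simp [hg]
  have he : cfcₙ g d = cfcₙ k d * d * cfcₙ k d := by
    rw [hg, cfcₙ_mul (fun t => k t * t) k d, cfcₙ_mul k (fun t => t) d, cfcₙ_id' ℝ d]
  have hf : cfcₙ (fun t => t - g t * t - t * g t + g t * t * g t) d
      = d - cfcₙ g d * d - d * cfcₙ g d + cfcₙ g d * d * cfcₙ g d := by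
    rw [cfcₙ_add (fun t => t - g t * t - t * g t) (fun t => g t * t * g t) d,
      cfcₙ_sub (fun t => t - g t * t) (fun t => t * g t) d,
      cfcₙ_sub (fun t => t) (fun t => g t * t) d, cfcₙ_mul (fun t => g t * t) g d,
      cfcₙ_mul g (fun t => t) d, cfcₙ_mul (fun t => t) g d, cfcₙ_id' ℝ d]
  rw [← he, ← hf]
  refine norm_cfcₙ_le fun t ht => ?_
  have ht0 : 0 ≤ t := quasispectrum_nonneg_of_nonneg d hd t ht
  have hgt : g t = (t / (t + η)) ^ 2 := by
    simp only [hg, hk, abs_of_nonneg ht0]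
    rw [div_mul_eq_mul_div, div_mul_div_comm, mul_right_comm, Real.mul_self_sqrt ht0, div_pow,
      sq, sq]
  rw [hgt]
  exact abs_local_unit_error_le ht0 hη

/-- Comparable positive elements are Cuntz comparable: if `e = s d s` is an approximate unit for
`d`, then it is one for `r = √c`, so that `c = r r` is close to `r e r = (s r)* d (s r)`. -/
theorem cuntzBelow_of_le {c d : B} (hc : 0 ≤ c) (hcd : c ≤ d) : CuntzBelow c d := by
  intro ε hε
  set r := CFC.sqrt c with hr
  have hrr : r * r = c := CFC.sqrt_mul_sqrt_self c
  have hrs : star r = r := (CFC.sqrt_nonneg c).isSelfAdjoint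
  obtain ⟨s, hs, hsd⟩ := exists_isSelfAdjoint_norm_le (hc.trans hcd)
    (η := ε ^ 2 / (4 * (‖r‖ ^ 2 + 1))) (by positivity)
  set e := s * d * s with he
  have hes : star e = e := by
    simp [he, hs.star_eq, (hc.trans hcd).isSelfAdjoint.star_eq, mul_assoc]
  refine ⟨s * r, ?_⟩
  have h1 : c - star (s * r) * d * (s * r) = r * (r - e * r) := by
    rw [← hrr, star_mul, hrs, hs.star_eq, he]; noncomm_ring
  have h2 : (r - e * r) * star (r - e * r) = c - e * c - c * e + e * c * e := by
    rw [star_sub, star_mul, hrs, hes, ← hrr]; noncomm_ring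
  have h3 : c - e * c - c * e + e * c * e ≤ d - e * d - d * e + e * d * e := by
    obtain ⟨q, hq⟩ := CStarAlgebra.nonneg_iff_eq_star_mul_self.1 (sub_nonneg.2 hcd)
    rw [← sub_nonneg]
    have : d - e * d - d * e + e * d * e - (c - e * c - c * e + e * c * e)
        = star (q - q * e) * (q - q * e) := by
      have : star (q - q * e) * (q - q * e)
          = star q * q - e * (star q * q) - (star q * q) * e + e * (star q * q) * e := by
        rw [star_sub, star_mul, hes]; noncomm_ring
      rw [this, ← hq]; noncomm_ring
    rw [this]
    exact star_mul_self_nonneg _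
  have h4 : ‖r - e * r‖ ^ 2 ≤ 2 * (ε ^ 2 / (4 * (‖r‖ ^ 2 + 1))) := by
    rw [sq, ← CStarRing.norm_self_mul_star, h2]
    refine (CStarAlgebra.norm_le_norm_of_nonneg_of_le ?_ h3).trans hsd
    rw [← h2]
    exact mul_star_self_nonneg _
  rw [h1]
  refine lt_of_pow_lt_pow_left₀ 2 hε.le ?_
  calc ‖r * (r - e * r)‖ ^ 2 ≤ (‖r‖ * ‖r - e * r‖) ^ 2 := by gcongr; exact norm_mul_le _ _
    _ = ‖r‖ ^ 2 * ‖r - e * r‖ ^ 2 := by ring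
    _ ≤ (‖r‖ ^ 2 + 1) * (2 * (ε ^ 2 / (4 * (‖r‖ ^ 2 + 1)))) := by gcongr; linarith
    _ = ε ^ 2 / 2 := by field_simp; ring
    _ < ε ^ 2 := by linarith [pow_pos hε 2]

/-- If a positive element of `B` is closer to a self-adjoint element `a` of `A` than a third of
`‖a‖`, then it dominates a nonzero positive element of `A`. The element is the cube of the positive
part of `u = a (a - ε) a`, which equals `e* (a - ε) e` for `e = a u₊`. -/
theorem exists_cuntzBelow_of_norm_sub_le [PartialOrder A] [StarOrderedRing A]
    (ι : A →⋆ₙₐ[ℂ] B) (hι : Function.Injective ι) {y : B} (hy : 0 ≤ y) {a : A}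
    (ha : IsSelfAdjoint a) {ε : ℝ} (hya : ‖y - ι a‖ ≤ ε) (hε : 3 * ε < ‖a‖) :
    ∃ c : A, 0 ≤ c ∧ c ≠ 0 ∧ CuntzBelow (ι c) y := by
  have hιm : Monotone ι := OrderHomClass.mono ι
  have hε0 : 0 ≤ ε := (norm_nonneg _).trans hya
  have hιa : IsSelfAdjoint (ι a) := ha.map ι
  have hz : IsSelfAdjoint (ι a - y) := hιa.sub hy.isSelfAdjoint
  have hzn : ‖ι a - y‖ ≤ ε := by rwa [norm_sub_rev]
  have conj (x : B) : star x * ι a * x - ε • (star x * x) ≤ star x * y * x := by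
    have h1 := CStarAlgebra.star_left_conjugate_le_norm_smul (a := x) (b := ι a - y)
    have h2 : ‖ι a - y‖ • (star x * x) ≤ ε • (star x * x) :=
      smul_le_smul_of_nonneg_right hzn (star_mul_self_nonneg x)
    have h3 : star x * (ι a - y) * x = star x * ι a * x - star x * y * x := by noncomm_ring
    rw [h3] at h1
    rw [sub_le_comm]
    exact h1.trans h2
  set u := a * a * a - ε • (a * a) with hu
  have husa : IsSelfAdjoint u := by
    rw [IsSelfAdjoint, hu, star_sub, star_smul, star_mul, star_mul, ha.star_eq, star_trivial,
      mul_assoc]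
  have hp : star u⁺ = u⁺ := (CFC.posPart_nonneg u).isSelfAdjoint
  set e := a * u⁺ with he
  have hc : star e * a * e - ε • (star e * e) = star u⁺ * u⁺ * u⁺ := by
    have h1 : star e * a * e - ε • (star e * e) = u⁺ * u * u⁺ := by
      rw [he, star_mul, hp, ha.star_eq, hu, mul_sub, sub_mul, mul_smul_comm, smul_mul_assoc]
      simp only [mul_assoc]
    rw [h1, hp]
    congr 1
    have h2 : u⁺ * u = u⁺ * (u⁺ - u⁻) := by rw [CFC.posPart_sub_negPart u]
    rw [h2, mul_sub, CFC.posPart_mul_negPart, sub_zero]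
  have hc0 : 0 ≤ star u⁺ * u⁺ * u⁺ := by
    have := star_left_conjugate_nonneg (CFC.posPart_nonneg u) u⁺
    exact this
  refine ⟨_, hc0, ?_, ?_⟩
  · intro h0
    have hu0 : u⁺ = 0 := by
      have := norm_cube_of_isSelfAdjoint (a := u⁺) hp
      rw [← hp] at this
      nth_rewrite 2 [hp] at this
      nth_rewrite 2 [hp] at this
      rw [h0, norm_zero, eq_comm, hp] at this
      exact norm_eq_zero.1 (pow_eq_zero_iff (by norm_num) |>.1 this)
    have hule : u ≤ 0 := (CFC.posPart_eq_zero_iff u husa).1 hu0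
    have h1 : ι a * ι a * ι a ≤ ε • (ι a * ι a) := by
      have := hιm (sub_nonpos.1 hule)
      rwa [map_mul, map_mul, map_real_smul ι (continuous_starHom ι), map_mul] at this
    have h2 : ι a * y * ι a ≤ (2 * ε) • (ι a * ι a) := by
      have h3 := CStarAlgebra.star_left_conjugate_le_norm_smul (a := ι a) (b := y - ι a)
        (by rw [← neg_sub]; exact hz.neg)
      have h4 : ‖y - ι a‖ • (star (ι a) * ι a) ≤ ε • (star (ι a) * ι a) :=
        smul_le_smul_of_nonneg_right hya (star_mul_self_nonneg _)
      have h5 := h3.trans h4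
      rw [hιa.star_eq, mul_sub, sub_mul] at h5
      calc ι a * y * ι a ≤ ε • (ι a * ι a) + ι a * ι a * ι a := sub_le_iff_le_add.1 h5
        _ ≤ ε • (ι a * ι a) + ε • (ι a * ι a) := by gcongr
        _ = _ := by rw [two_mul, add_smul]
    have h6 : 0 ≤ ι a * y * ι a := by
      have := star_left_conjugate_nonneg hy (ι a)
      rwa [hιa.star_eq] at this
    have h7 : ‖ι a * y * ι a‖ ≤ 2 * ε * ‖ι a‖ ^ 2 := by
      refine (CStarAlgebra.norm_le_norm_of_nonneg_of_le h6 h2).trans ?_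
      rw [norm_smul, Real.norm_eq_abs, abs_of_nonneg (by positivity), sq]
      gcongr
      exact norm_mul_le _ _
    have h8 : ‖ι a * ι a * ι a - ι a * y * ι a‖ ≤ ε * ‖ι a‖ ^ 2 := by
      have h9 : ι a * ι a * ι a - ι a * y * ι a = star (ι a) * (ι a - y) * ι a := by
        rw [hιa.star_eq]; noncomm_ring
      rw [h9]
      exact (norm_conjugate_le _ _).trans (by gcongr)
    have h10 : ‖ι a‖ ^ 3 ≤ 3 * ε * ‖ι a‖ ^ 2 := by
      rw [← norm_cube_of_isSelfAdjoint hιa]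
      have := norm_le_norm_add_norm_sub' (ι a * ι a * ι a) (ι a * y * ι a)
      linarith
    rw [NonUnitalStarAlgHom.norm_map ι hι] at h10
    have hpos : 0 < ‖a‖ := by linarith
    have h11 : ‖a‖ ^ 2 * ‖a‖ ≤ ‖a‖ ^ 2 * (3 * ε) := by linarith
    linarith [le_of_mul_le_mul_left h11 (by positivity)]
  · refine (cuntzBelow_of_le ?_ ?_).trans (cuntzBelow_conjugate y (ι e))
    · exact map_nonneg ι hc0
    · have := conj (ι e)
      rw [← hc, map_sub, map_real_smul ι (continuous_starHom ι)]
      simpa only [map_mul, map_star] using this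

end Cuntz

/-! ### Completely positive contractions -/

section CompletelyPositive

variable {B C : Type*} [NonUnitalCStarAlgebra B] [PartialOrder B] [StarOrderedRing B]
  [NonUnitalCStarAlgebra C] [PartialOrder C] [StarOrderedRing C]

/-- Positivity of `z` may be tested on the conjugates `w* z w`. -/
theorem nonneg_of_forall_conjugate {z : C} (h : ∀ w : C, 0 ≤ star w * z * w) : 0 ≤ z := by
  have hl := CStarAlgebra.increasingApproximateUnit C
  have := hl.neBot
  have h1 : Tendsto (fun e : C => e * z * e) (CStarAlgebra.approximateUnit C) (𝓝 z) := by
    have h2 : Tendsto (fun e : C => e * z) (CStarAlgebra.approximateUnit C) (𝓝 z) :=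
      hl.tendsto_mul_right z
    have h3 : Tendsto (fun e : C => z * e) (CStarAlgebra.approximateUnit C) (𝓝 z) :=
      hl.tendsto_mul_left z
    have h4 : Tendsto (fun e : C => (e * z - z) * e) (CStarAlgebra.approximateUnit C) (𝓝 0) := by
      refine squeeze_zero_norm' (a := fun e : C => ‖e * z - z‖) ?_ ?_
      · filter_upwards [hl.eventually_norm] with e he
        exact (norm_mul_le _ _).trans (mul_le_of_le_one_right (norm_nonneg _) he)
      · simpa using (h2.sub_const z).norm
    simpa [sub_mul] using h4.add h3
  refine isClosed_Ici.mem_of_tendsto h1 ?_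
  filter_upwards [hl.eventually_star_eq] with e he
  have := h e
  rwa [he] at this

theorem exists_eq_star_mul_self_of_nonneg {z : C} (hz : 0 ≤ z) : ∃ s : C, z = star s * s :=
  CStarAlgebra.nonneg_iff_eq_star_mul_self.1 hz

/-- A positive `2 × 2` matrix `P` with contractive corner `P 1 1` satisfies
`(P 1 0)* (P 1 0) ≤ P 0 0`: test positivity on the vectors `(w, -(P 1 0) w)`. -/
theorem star_mul_self_le_of_cstarMatrix_nonneg {P : CStarMatrix (Fin 2) (Fin 2) C} (hP : 0 ≤ P)
    (h : ‖P 1 1‖ ≤ 1) : star (P 1 0) * P 1 0 ≤ P 0 0 := by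
  obtain ⟨S, hS⟩ := exists_eq_star_mul_self_of_nonneg hP
  have hent (i k : Fin 2) : P i k = star (S 0 i) * S 0 k + star (S 1 i) * S 1 k := by
    rw [hS, CStarMatrix.mul_apply, Fin.sum_univ_two, CStarMatrix.star_apply,
      CStarMatrix.star_apply]
  have hsa (i k : Fin 2) : star (P i k) = P k i := by
    rw [hent, hent, star_add, star_mul, star_mul, star_star, star_star]
  rw [← sub_nonneg]
  refine nonneg_of_forall_conjugate fun w => ?_
  have h1 : 0 ≤ star w * P 0 0 * w - star w * P 0 1 * (P 1 0 * w)
      - star (P 1 0 * w) * P 1 0 * w + star (P 1 0 * w) * P 1 1 * (P 1 0 * w) := by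
    have h2 : star w * P 0 0 * w - star w * P 0 1 * (P 1 0 * w)
        - star (P 1 0 * w) * P 1 0 * w + star (P 1 0 * w) * P 1 1 * (P 1 0 * w)
        = star (S 0 0 * w - S 0 1 * (P 1 0 * w)) * (S 0 0 * w - S 0 1 * (P 1 0 * w))
          + star (S 1 0 * w - S 1 1 * (P 1 0 * w)) * (S 1 0 * w - S 1 1 * (P 1 0 * w)) := by
      generalize P 1 0 * w = v
      simp only [hent, star_sub, star_mul]
      noncomm_ring
    rw [h2]
    exact add_nonneg (star_mul_self_nonneg _) (star_mul_self_nonneg _)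
  have h3 : star (P 1 0 * w) * P 1 1 * (P 1 0 * w) ≤ star (P 1 0 * w) * (P 1 0 * w) := by
    refine (CStarAlgebra.star_left_conjugate_le_norm_smul (hsa 1 1)).trans ?_
    exact (smul_le_smul_of_nonneg_right h (star_mul_self_nonneg _)).trans_eq (one_smul _ _)
  refine h1.trans ((add_le_add_right h3 _).trans_eq ?_)
  rw [← hsa 1 0, star_mul]
  noncomm_ring

/-- The Kadison–Schwarz inequality for completely positive contractions. -/
theorem star_map_mul_map_le (φ : B →CP C) (hφ : ∀ b, ‖φ b‖ ≤ ‖b‖) (x : B) :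
    star (φ x) * φ x ≤ φ (star x * x) := by
  have hl := CStarAlgebra.increasingApproximateUnit B
  have := hl.neBot
  have hc : Continuous φ :=
    AddMonoidHomClass.continuous_of_bound φ 1 fun b => by rw [one_mul]; exact hφ b
  have hlim : Tendsto (fun e : B => star (φ (e * x)) * φ (e * x)) (CStarAlgebra.approximateUnit B)
      (𝓝 (star (φ x) * φ x)) := by
    have h1 := (hc.tendsto x).comp (hl.tendsto_mul_right x)
    exact h1.star.mul h1
  refine le_of_tendsto hlim ?_
  filter_upwards [hl.eventually_star_eq, hl.eventually_norm] with e he he1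
  let N : CStarMatrix (Fin 2) (Fin 2) B := CStarMatrix.ofMatrix !![x, e; 0, 0]
  have hN (i k : Fin 2) : (star N * N) i k = star (N 0 i) * N 0 k := by
    rw [CStarMatrix.mul_apply, Fin.sum_univ_two, CStarMatrix.star_apply, CStarMatrix.star_apply]
    have : N 1 k = 0 := by fin_cases k <;> rfl
    rw [this, mul_zero, add_zero]
  have hpos : 0 ≤ (star N * N).map φ := φ.map_cstarMatrix_nonneg _ (star_mul_self_nonneg N)
  have h10 : ((star N * N).map φ) 1 0 = φ (e * x) := by
    rw [CStarMatrix.map_apply, hN]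
    change φ (star e * x) = _
    rw [he]
  have h := star_mul_self_le_of_cstarMatrix_nonneg hpos (by
    rw [CStarMatrix.map_apply, hN]
    change ‖φ (star e * e)‖ ≤ 1
    refine (hφ _).trans ?_
    rw [CStarRing.norm_star_mul_self]
    exact mul_le_one₀ he1 (norm_nonneg _) he1)
  rw [h10, CStarMatrix.map_apply, hN] at h
  exact h

theorem eq_zero_of_forall_smul_nonneg {p q : C} (h : ∀ t : ℝ, 0 ≤ p + t • q) : q = 0 := by
  have key (q : C) (h : ∀ t : ℝ, 0 ≤ p + t • q) : 0 ≤ q := by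
    have h1 : Tendsto (fun t : ℝ => t⁻¹ • p + q) atTop (𝓝 (0 + q)) := by
      refine Tendsto.add_const q ?_
      simpa using (tendsto_inv_atTop_zero (𝕜 := ℝ)).smul_const p
    rw [zero_add] at h1
    refine isClosed_Ici.mem_of_tendsto h1 ?_
    filter_upwards [eventually_gt_atTop 0] with t ht
    have h2 := smul_nonneg (inv_nonneg.2 ht.le) (h t)
    rwa [smul_add, inv_smul_smul₀ ht.ne'] at h2
  refine le_antisymm ?_ (key q h)
  rw [← neg_nonneg]
  exact key (-q) fun t => by simpa using h (-t)

/-- Elements with equality in the Kadison–Schwarz inequality lie in the multiplicative domain. -/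
theorem map_star_mul_of_eq (φ : B →CP C) (hφ : ∀ b, ‖φ b‖ ≤ ‖b‖) {a : B}
    (ha : φ (star a * a) = star (φ a) * φ a) (b : B) : φ (star a * b) = star (φ a) * φ b := by
  -- `D x y = φ (x* y) - φ(x)* φ(y)` is positive semidefinite and `D a a = 0`.
  have hφs (x : B) : φ (star x) = star (φ x) := map_star φ x
  have key (b : B) : (φ (star a * b) - star (φ a) * φ b)
      + star (φ (star a * b) - star (φ a) * φ b) = 0 := by
    refine eq_zero_of_forall_smul_nonneg (p := φ (star b * b) - star (φ b) * φ b) fun t => ?_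
    have h1 := sub_nonneg.2 (star_map_mul_map_le φ hφ (b + (t : ℂ) • a))
    have h2 : (t : ℝ) • ((φ (star a * b) - star (φ a) * φ b)
        + star (φ (star a * b) - star (φ a) * φ b))
        = (t : ℂ) • ((φ (star a * b) - star (φ a) * φ b)
        + star (φ (star a * b) - star (φ a) * φ b)) := (Complex.coe_smul _ _).symm
    rw [h2]
    convert h1 using 1
    simp only [star_add, star_smul, map_add, map_smul, mul_add, add_mul, star_sub, star_mul,
      ← hφs, smul_mul_assoc, mul_smul_comm, star_star, Complex.star_def, Complex.conj_ofReal]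
    rw [ha, ← hφs]
    module
  have h1 := key b
  have h2 := key (Complex.I • b)
  have h3 : φ (star a * (Complex.I • b)) - star (φ a) * φ (Complex.I • b)
      = Complex.I • (φ (star a * b) - star (φ a) * φ b) := by
    rw [mul_smul_comm, map_smul, map_smul, mul_smul_comm, smul_sub]
  rw [h3, star_smul, Complex.star_def, Complex.conj_I] at h2
  rw [← sub_eq_zero]
  generalize φ (star a * b) - star (φ a) * φ b = z at *
  have h4 : Complex.I • (z - star z) = 0 := by rw [← h2]; module
  have h5 : z - star z = 0 := by simpa using h4
  have h6 : (2 : ℂ) • z = (z + star z) + (z - star z) := by module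
  rw [h1, h5, add_zero] at h6
  simpa using h6

end CompletelyPositive

section Bimodule

variable {A B A' : Type*} [NonUnitalCStarAlgebra A] [NonUnitalCStarAlgebra B]
  [NonUnitalCStarAlgebra A'] [PartialOrder B] [StarOrderedRing B] [PartialOrder A']
  [StarOrderedRing A'] {ι : A →⋆ₙₐ[ℂ] B} {j : A →⋆ₙₐ[ℂ] A'}

namespace GeneralisedExpectation

theorem norm_apply_le (E : GeneralisedExpectation ι j) (b : B) : ‖E b‖ ≤ ‖b‖ := E.norm_map_le b

theorem apply_incl (E : GeneralisedExpectation ι j) (a : A) : E (ι a) = j a := E.map_incl a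

theorem continuous (E : GeneralisedExpectation ι j) : Continuous E :=
  AddMonoidHomClass.continuous_of_bound E.toCompletelyPositiveMap 1 fun b => by
    rw [one_mul]; exact E.norm_apply_le b

theorem apply_star (E : GeneralisedExpectation ι j) (b : B) : E (star b) = star (E b) :=
  map_star E.toCompletelyPositiveMap b

theorem apply_incl_mul (E : GeneralisedExpectation ι j) (a : A) (b : B) :
    E (ι a * b) = j a * E b := by
  have h := map_star_mul_of_eq E.toCompletelyPositiveMap E.norm_apply_le (a := ι (star a)) (by
    rw [← map_star, ← map_mul, apply_incl, apply_incl, ← map_star, ← map_mul]) b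
  rwa [apply_incl, ← map_star, ← map_star, star_star] at h

theorem apply_mul_incl (E : GeneralisedExpectation ι j) (b : B) (a : A) :
    E (b * ι a) = E b * j a := by
  have h := E.apply_incl_mul (star a) (star b)
  apply star_injective
  rw [← E.apply_star, star_mul, star_mul, ← E.apply_star, ← map_star, ← map_star, h]

end GeneralisedExpectation

end Bimodule

/-! ### The ideal `𝒩_E` -/

namespace ClosedIdeal

variable {B : Type*} [NonUnitalCStarAlgebra B]

theorem le_closedSpan {S : Set (ClosedIdeal B)} {J : ClosedIdeal B} (hJ : J ∈ S) :
    J ≤ closedSpan S :=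
  fun _ hx => subset_closure (Submodule.subset_span ⟨J, hJ, hx⟩)

theorem closedSpan_le {S : Set (ClosedIdeal B)} {K : ClosedIdeal B} (h : ∀ J ∈ S, J ≤ K) :
    closedSpan S ≤ K := by
  intro x hx
  refine closure_minimal (s := (Submodule.span ℂ {x : B | ∃ J ∈ S, x ∈ J} : Set B)) ?_
    K.isClosed hx
  have : Submodule.span ℂ {x : B | ∃ J ∈ S, x ∈ J} ≤ K.toSubmodule :=
    Submodule.span_le.2 fun x ⟨J, hJ, hx⟩ => h J hJ hx
  exact this

theorem mem_of_star_mul_self_mem {J : ClosedIdeal B} {b : B} (h : star b * b ∈ J) : b ∈ J := by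
  have h1 : J.quotMap (star b * b) = 0 := by
    change J.mkₗ _ = 0
    rw [← J.mkₗ.map_zero, mkₗ_eq_iff, sub_zero]
    exact h
  rw [map_mul, map_star, CStarRing.star_mul_self_eq_zero_iff] at h1
  have h2 : J.mkₗ b = J.mkₗ 0 := h1.trans J.mkₗ.map_zero.symm
  simpa using J.mkₗ_eq_iff.1 h2

theorem quotMap_eq_zero_iff {J : ClosedIdeal B} {b : B} : J.quotMap b = 0 ↔ b ∈ J := by
  change J.mkₗ b = 0 ↔ _
  rw [← J.mkₗ.map_zero, mkₗ_eq_iff, sub_zero]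

theorem quotMap_surjective (J : ClosedIdeal B) : Function.Surjective J.quotMap :=
  J.mkₗ_surjective

end ClosedIdeal

namespace GeneralisedExpectation

variable {A B A' : Type*} [NonUnitalCStarAlgebra A] [NonUnitalCStarAlgebra B]
  [NonUnitalCStarAlgebra A'] [PartialOrder B] [StarOrderedRing B] [PartialOrder A']
  [StarOrderedRing A'] {ι : A →⋆ₙₐ[ℂ] B} {j : A →⋆ₙₐ[ℂ] A'}

theorem apply_eq_zero_of_forall_mul_mul (E : GeneralisedExpectation ι j) {z : B}
    (h : ∀ x y : B, E (x * z * y) = 0) : E z = 0 := by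
  have hl := CStarAlgebra.increasingApproximateUnit B
  have := hl.neBot
  have h1 (x : B) : E (x * z) = 0 :=
    tendsto_nhds_unique ((E.continuous.tendsto _).comp (hl.tendsto_mul_left (x * z)))
      (tendsto_const_nhds.congr fun e => (h x e).symm)
  exact tendsto_nhds_unique ((E.continuous.tendsto _).comp (hl.tendsto_mul_right z))
      (tendsto_const_nhds.congr fun e => (h1 e).symm)

theorem mem_nullIdeal_iff (E : GeneralisedExpectation ι j) {z : B} :
    z ∈ E.nullIdeal ↔ ∀ x y : B, E (x * z * y) = 0 := by
  let N : ClosedIdeal B :=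
    { carrier := {z | ∀ x y : B, E (x * z * y) = 0}
      add_mem' := fun {a b} ha hb x y => by rw [mul_add, add_mul, map_add, ha, hb, add_zero]
      zero_mem' := fun x y => by rw [mul_zero, zero_mul, map_zero]
      smul_mem' := fun c a ha x y => by
        rw [mul_smul_comm, smul_mul_assoc, map_smul, ha, smul_zero]
      mul_mem_left' := fun b a ha x y => by rw [← mul_assoc]; exact ha _ y
      mul_mem_right' := fun b a ha x y => by rw [← mul_assoc, mul_assoc]; exact ha x _
      isClosed' := by
        simp only [Set.ofPred_forall]
        exact isClosed_iInter fun x => isClosed_iInter fun y =>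
          isClosed_eq (E.continuous.comp (by fun_prop)) continuous_const }
  have hN : E.nullIdeal = N := by
    refine le_antisymm (ClosedIdeal.closedSpan_le fun J hJ z hz x y =>
      hJ _ (J.mul_mem_right _ (J.mul_mem_left _ hz))) (ClosedIdeal.le_closedSpan fun z hz => ?_)
    exact E.apply_eq_zero_of_forall_mul_mul hz
  rw [hN]
  exact Iff.rfl

theorem apply_eq_zero_of_mem_nullIdeal (E : GeneralisedExpectation ι j) {z : B}
    (hz : z ∈ E.nullIdeal) : E z = 0 :=
  E.apply_eq_zero_of_forall_mul_mul (E.mem_nullIdeal_iff.1 hz)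

/-- Membership in `𝒩_E` may be tested on the conjugates `x* z x`, by polarisation. -/
theorem mem_nullIdeal_of_forall_conjugate (E : GeneralisedExpectation ι j) {z : B}
    (h : ∀ x : B, E (star x * z * x) = 0) : z ∈ E.nullIdeal := by
  have key (x y : B) : E (star x * z * y) + E (star y * z * x) = 0 := by
    have h1 := h (x + y)
    rw [star_add, add_mul, add_mul, mul_add, mul_add, map_add, map_add, map_add, h, h, zero_add,
      add_zero] at h1
    exact h1
  refine E.mem_nullIdeal_iff.2 fun x y => ?_
  have h1 := key (star x) y
  have h2 := key (star x) (Complex.I • y)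
  rw [star_smul, Complex.star_def, Complex.conj_I, mul_smul_comm, smul_mul_assoc, smul_mul_assoc,
    map_smul, map_smul] at h2
  rw [star_star] at h1 h2
  have h3 : (2 : ℂ) • E (x * z * y) = (E (x * z * y) + E (star y * z * star x))
      - Complex.I • (Complex.I • E (x * z * y) + -Complex.I • E (star y * z * star x)) := by
    simp only [smul_add, smul_smul, mul_neg, Complex.I_mul_I]
    module
  rw [h1, h2, smul_zero, sub_zero] at h3
  simpa using h3

theorem meetsTrivially_nullIdeal (E : GeneralisedExpectation ι j) (hj : Function.Injective j) :
    MeetsTrivially ι E.nullIdeal := by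
  intro a ha
  have h1 := E.apply_eq_zero_of_mem_nullIdeal ha
  rw [E.apply_incl, map_eq_zero_iff j hj] at h1
  rw [h1, map_zero]

section Support

variable [PartialOrder A] [StarOrderedRing A]

/-- A positive element with nonzero expectation dominates a nonzero positive element of `A`.
Aperiodicity compresses `b` to an element close to `A`, and supportivity keeps the compression away
from zero. -/
theorem exists_cuntzBelow_of_apply_ne_zero (E : GeneralisedExpectation ι j)
    (hι : Function.Injective ι) (hj : Function.Injective j) (hap : IsAperiodic ι)
    (hE : E.IsSupportive) {b : B} (hb : 0 ≤ b) (hEb : E b ≠ 0) :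
    ∃ a : A, 0 ≤ a ∧ a ≠ 0 ∧ CuntzBelow (ι a) b := by
  obtain ⟨δ, hδ, D, hD, hD0, hDδ⟩ := hE b hb hEb
  obtain ⟨a, haD, ha0, ha1, hab⟩ := hap b D hD hD0 (δ / 4) (by linarith)
  have has : star a = a := ha0.isSelfAdjoint
  set y := ι a * b * ι a with hy
  have hy0 : 0 ≤ y := by
    have := star_left_conjugate_nonneg hb (ι a)
    rwa [← map_star, has] at this
  obtain ⟨z, hz, hzn⟩ := Submodule.Quotient.norm_mk_lt
    (S := LinearMap.range ((ι : A →ₙₐ[ℂ] B) : A →ₗ[ℂ] B)) (Submodule.Quotient.mk y)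
    (sub_pos.2 hab)
  rw [add_sub_cancel] at hzn
  obtain ⟨c, hc⟩ := (Submodule.Quotient.eq _).1 hz
  have hc' : ι c = z - y := hc
  -- the real part `a₁` of `-c` is an element of `A` close to `y`
  set a₁ : A := -((2⁻¹ : ℂ) • (c + star c)) with ha₁
  have ha₁s : IsSelfAdjoint a₁ := by
    rw [IsSelfAdjoint, ha₁, star_neg, star_smul, star_add, star_star, add_comm]
    simp
  have hya : y - ι a₁ = (2⁻¹ : ℂ) • (z + star z) := by
    have : star z = y + star (ι c) := by rw [hc', star_sub, hy0.isSelfAdjoint.star_eq]; abel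
    rw [this, ha₁, map_neg, map_smul, map_add, map_star, eq_sub_iff_add_eq.1 hc' |>.symm]
    module
  have hyan : ‖y - ι a₁‖ < δ / 4 := by
    rw [hya, norm_smul]
    have := norm_add_le z (star z)
    rw [norm_star] at this
    norm_num
    linarith
  -- `j a₁` is within `δ / 4` of `a E(b) a`, whose norm is at least `δ`
  have hbig : 3 * (δ / 4) < ‖a₁‖ := by
    have h1 : E y = j a * E b * j a := by rw [hy, E.apply_mul_incl, E.apply_incl_mul]
    have h2 : δ ≤ ‖E y‖ := by rw [h1]; exact hDδ a haD ha0 ha1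
    have h3 : ‖E y - j a₁‖ ≤ ‖y - ι a₁‖ := by
      rw [← E.apply_incl, ← map_sub]
      exact E.norm_apply_le _
    have h4 := norm_le_norm_add_norm_sub' (E y) (j a₁)
    rw [NonUnitalStarAlgHom.norm_map j hj] at h4
    linarith
  obtain ⟨d, hd0, hd, hdy⟩ := exists_cuntzBelow_of_norm_sub_le ι hι hy0 ha₁s hyan.le hbig
  refine ⟨d, hd0, hd, hdy.trans ?_⟩
  have := cuntzBelow_conjugate b (ι a)
  rwa [← map_star, has] at this

theorem exists_cuntzBelow_of_notMem_nullIdeal (E : GeneralisedExpectation ι j)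
    (hι : Function.Injective ι) (hj : Function.Injective j) (hap : IsAperiodic ι)
    (hE : E.IsSupportive) {b : B} (hb : 0 ≤ b) (hbN : b ∉ E.nullIdeal) :
    ∃ a : A, 0 ≤ a ∧ a ≠ 0 ∧ CuntzBelow (ι a) b := by
  have : ∃ x : B, E (star x * b * x) ≠ 0 := by
    by_contra! h
    exact hbN (E.mem_nullIdeal_of_forall_conjugate h)
  obtain ⟨x, hx⟩ := this
  obtain ⟨a, ha0, ha, hab⟩ := E.exists_cuntzBelow_of_apply_ne_zero hι hj hap hE
    (star_left_conjugate_nonneg hb x) hx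
  exact ⟨a, ha0, ha, hab.trans (cuntzBelow_conjugate b x)⟩

theorem le_nullIdeal_of_meetsTrivially (E : GeneralisedExpectation ι j)
    (hι : Function.Injective ι) (hj : Function.Injective j) (hap : IsAperiodic ι)
    (hE : E.IsSupportive) {J : ClosedIdeal B} (hJ : MeetsTrivially ι J) : J ≤ E.nullIdeal := by
  intro b hb
  by_contra hbN
  obtain ⟨a, -, ha, hab⟩ := E.exists_cuntzBelow_of_notMem_nullIdeal hι hj hap hE
    (star_mul_self_nonneg b) fun h => hbN (ClosedIdeal.mem_of_star_mul_self_mem h)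
  exact ha ((map_eq_zero_iff ι hι).1 (hJ a (hab.mem (J.mul_mem_left _ hb))))

theorem supports_quotient (E : GeneralisedExpectation ι j)
    (hι : Function.Injective ι) (hj : Function.Injective j) (hap : IsAperiodic ι)
    (hE : E.IsSupportive) : Supports (E.nullIdeal.quotMap.comp ι) := by
  intro c hc hc0
  obtain ⟨s, rfl⟩ := CStarAlgebra.nonneg_iff_eq_star_mul_self.1 hc
  obtain ⟨t, rfl⟩ := E.nullIdeal.quotMap_surjective s
  rw [← map_star, ← map_mul] at hc0 ⊢
  obtain ⟨a, ha0, ha, hab⟩ := E.exists_cuntzBelow_of_notMem_nullIdeal hι hj hap hE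
    (star_mul_self_nonneg t) fun h => hc0 (ClosedIdeal.quotMap_eq_zero_iff.2 h)
  exact ⟨a, ha0, ha, hab.map _⟩

end Support

end GeneralisedExpectation

section Hidden

variable {A B C : Type*} [NonUnitalCStarAlgebra A] [NonUnitalCStarAlgebra B]
  [NonUnitalCStarAlgebra C]

theorem MeetsTrivially.injective {ι : A →⋆ₙₐ[ℂ] B} (hι : Function.Injective ι)
    {J : ClosedIdeal B} (hJ : MeetsTrivially ι J) : Function.Injective (J.quotMap.comp ι) := by
  rw [injective_iff_map_eq_zero]
  intro a ha
  exact (map_eq_zero_iff ι hι).1 (hJ a (ClosedIdeal.quotMap_eq_zero_iff.1 ha))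

theorem meetsTrivially_kerIdeal {ι : A →⋆ₙₐ[ℂ] B} {π : B →⋆ₙₐ[ℂ] C}
    (h : Function.Injective (π.comp ι)) : MeetsTrivially ι (kerIdeal π) := by
  intro a ha
  have h1 : π.comp ι a = 0 := ha
  rw [map_eq_zero_iff _ h] at h1
  rw [h1, map_zero]

theorem kerIdeal_quotMap (J : ClosedIdeal B) : kerIdeal J.quotMap = J :=
  SetLike.ext fun _ => ClosedIdeal.quotMap_eq_zero_iff

/-- If the positive cone of `A` supports `C`, then `A` detects ideals in `C`. -/
theorem Supports.detectsIdeals [PartialOrder A] [PartialOrder C] [StarOrderedRing C]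
    {κ : A →⋆ₙₐ[ℂ] C} (hκ : Function.Injective κ) (h : Supports κ) : DetectsIdeals κ := by
  intro J hJ hm
  refine hJ (ClosedIdeal.eq_bot_iff.2 fun x hx => ?_)
  by_contra hx0
  obtain ⟨a, -, ha, hax⟩ := h (star x * x) (star_mul_self_nonneg x)
    (by rwa [Ne, CStarRing.star_mul_self_eq_zero_iff])
  exact ha ((map_eq_zero_iff κ hκ).1 (hm a (hax.mem (J.mul_mem_left _ hx))))

/-- A `*`-homomorphism that vanishes on the kernel of the surjection `p` factors through `p`. -/
theorem exists_factor_of_kerIdeal_le {P Q : Type*} [NonUnitalCStarAlgebra P]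
    [NonUnitalCStarAlgebra Q] {p : B →⋆ₙₐ[ℂ] P} (hp : Function.Surjective p) {q : B →⋆ₙₐ[ℂ] Q}
    (h : kerIdeal p ≤ kerIdeal q) : ∃ φ : P →⋆ₙₐ[ℂ] Q, φ.comp p = q := by
  have hwd {x y : B} (hxy : p x = p y) : q x = q y := by
    have h1 : x - y ∈ kerIdeal p := by
      change p (x - y) = 0
      rw [map_sub, hxy, sub_self]
    have h2 : q (x - y) = 0 := h h1
    rwa [map_sub, sub_eq_zero] at h2
  have hs (x : B) : q (Function.surjInv hp (p x)) = q x := hwd (Function.surjInv_eq hp _)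
  refine ⟨{ toFun := fun z => q (Function.surjInv hp z)
            map_smul' := fun c z => ?_
            map_zero' := ?_
            map_add' := fun z w => ?_
            map_mul' := fun z w => ?_
            map_star' := fun z => ?_ }, ?_⟩
  · obtain ⟨z, rfl⟩ := hp z
    simp only [← map_smul, hs]
    simp
  · rw [← map_zero p, hs, map_zero]
  · obtain ⟨z, rfl⟩ := hp z
    obtain ⟨w, rfl⟩ := hp w
    simp only [← map_add, hs]
  · obtain ⟨z, rfl⟩ := hp z
    obtain ⟨w, rfl⟩ := hp w
    simp only [← map_mul, hs]
  · obtain ⟨z, rfl⟩ := hp z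
    simp only [← map_star, hs]
  · exact NonUnitalStarAlgHom.ext hs

/-- If `J ≤ N` and `N` meets `A` trivially, then so does the image of `N` in `B / J`; hence `J = N`
as soon as `A` detects ideals in `B / J`. -/
theorem eq_of_le_of_detectsIdeals {ι : A →⋆ₙₐ[ℂ] B} {J N : ClosedIdeal B} (hJN : J ≤ N)
    (hN : MeetsTrivially ι N) (hd : DetectsIdeals (J.quotMap.comp ι)) : J = N := by
  obtain ⟨φ, hφ⟩ := exists_factor_of_kerIdeal_le J.quotMap_surjective (q := N.quotMap)
    (by rw [kerIdeal_quotMap, kerIdeal_quotMap]; exact hJN)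
  have hφ' (b : B) : φ (J.quotMap b) = N.quotMap b := DFunLike.congr_fun hφ b
  have hbot : kerIdeal φ = ⊥ := by
    by_contra h
    refine hd _ h fun a ha => ?_
    have h1 : φ (J.quotMap (ι a)) = 0 := ha
    rw [hφ', ClosedIdeal.quotMap_eq_zero_iff] at h1
    change J.quotMap (ι a) = 0
    rw [hN a h1, map_zero]
  refine le_antisymm hJN fun x hx => ?_
  rw [← ClosedIdeal.quotMap_eq_zero_iff] at hx ⊢
  rw [← hφ'] at hx
  exact ClosedIdeal.eq_bot_iff.1 hbot _ hx

end Hidden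

/-! ### Factorisation of generalised expectations through quotients -/

section Image

variable {A B A' C : Type*} [NonUnitalCStarAlgebra A] [NonUnitalCStarAlgebra B]
  [NonUnitalCStarAlgebra A'] [NonUnitalCStarAlgebra C]

theorem toImage_surjective (π : B →⋆ₙₐ[ℂ] C) : Function.Surjective (toImage π) := by
  rintro ⟨_, b, rfl⟩
  exact ⟨b, rfl⟩

theorem kerIdeal_toImage (π : B →⋆ₙₐ[ℂ] C) : kerIdeal (toImage π) = kerIdeal π :=
  SetLike.ext fun _ => Subtype.ext_iff

/-- The norm on `π(B)` is the quotient norm. -/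
theorem exists_toImage_eq_norm_lt (π : B →⋆ₙₐ[ℂ] C) (y : Image π) {ε : ℝ} (hε : 0 < ε) :
    ∃ b : B, toImage π b = y ∧ ‖b‖ < ‖y‖ + ε := by
  obtain ⟨b, rfl⟩ := toImage_surjective π y
  obtain ⟨x, hx, hxn⟩ := (kerIdeal π).exists_norm_lt ((kerIdeal π).mkₗ b) hε
  refine ⟨x, Subtype.ext ?_, hxn.trans_eq ?_⟩
  · change π x = π b
    rw [← kerLift_mk, hx, kerLift_mk]
  · have h := NonUnitalStarAlgHom.norm_map (kerLift π) (kerLift_injective π) ((kerIdeal π).mkₗ b)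
    rw [← h, kerLift_mk]
    rfl

variable [PartialOrder B] [StarOrderedRing B] [PartialOrder A'] [StarOrderedRing A']
  {ι : A →⋆ₙₐ[ℂ] B} {j : A →⋆ₙₐ[ℂ] A'}

/-- A generalised expectation that vanishes on the kernel of `π` descends to `π(B)`. Complete
positivity descends since positive matrices over `π(B)` lift to positive matrices over `B`. -/
theorem GeneralisedExpectation.exists_descend (E : GeneralisedExpectation ι j) (π : B →⋆ₙₐ[ℂ] C)
    (h : ∀ b ∈ kerIdeal π, E b = 0) :
    ∃ F : GeneralisedExpectation ((toImage π).comp ι) j, ∀ b : B, F (toImage π b) = E b := by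
  have hp := toImage_surjective π
  have hwd {x y : B} (hxy : toImage π x = toImage π y) : E x = E y := by
    have h1 : x - y ∈ kerIdeal π := by
      rw [← kerIdeal_toImage]
      change toImage π (x - y) = 0
      rw [map_sub, hxy, sub_self]
    have h2 := h _ h1
    rwa [map_sub, sub_eq_zero] at h2
  have hs (x : B) : E (Function.surjInv hp (toImage π x)) = E x :=
    hwd (Function.surjInv_eq hp _)
  let L : Image π →ₗ[ℂ] A' :=
    { toFun := fun y => E (Function.surjInv hp y)
      map_add' := fun z w => by
        obtain ⟨z, rfl⟩ := hp z
        obtain ⟨w, rfl⟩ := hp w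
        simp only [← map_add, hs]
      map_smul' := fun c z => by
        obtain ⟨z, rfl⟩ := hp z
        simp only [← map_smul, hs]
        simp }
  have hL (b : B) : L (toImage π b) = E b := hs b
  refine ⟨{ toLinearMap := L
            map_cstarMatrix_nonneg' := fun k M hM => ?_
            norm_map_le := fun y => ?_
            map_incl := fun a => ?_ }, hL⟩
  · obtain ⟨S, rfl⟩ := exists_eq_star_mul_self_of_nonneg hM
    let T : CStarMatrix (Fin k) (Fin k) B :=
      CStarMatrix.ofMatrix fun i l => Function.surjInv hp (S i l)
    have hT (i l : Fin k) : toImage π (T i l) = S i l := Function.surjInv_eq hp _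
    have h1 : (star S * S).map L = (star T * T).map E.toCompletelyPositiveMap := by
      refine CStarMatrix.ext fun i l => ?_
      rw [CStarMatrix.map_apply, CStarMatrix.map_apply, ← hL]
      congr 1
      simp only [CStarMatrix.mul_apply, CStarMatrix.star_apply, map_sum, map_mul, map_star, hT]
    rw [h1]
    exact E.map_cstarMatrix_nonneg _ (star_mul_self_nonneg T)
  · refine le_of_forall_pos_le_add fun ε hε => ?_
    obtain ⟨b, rfl, hb⟩ := exists_toImage_eq_norm_lt π y hε
    change ‖L _‖ ≤ _
    rw [hL]
    exact (E.norm_apply_le b).trans hb.le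
  · exact (hL (ι a)).trans (E.apply_incl a)

end Image

/-! ### Simplicity -/

section Simple

namespace ClosedIdeal

variable {B : Type*} [NonUnitalCStarAlgebra B]

/-- The closed linear span of `B S B`. -/
def mulSpan (S : Set B) : ClosedIdeal B where
  toSubmodule := (Submodule.span ℂ {z : B | ∃ x y : B, ∃ s ∈ S, z = x * s * y}).topologicalClosure
  mul_mem_left' b x hx := by
    refine map_mem_closure (continuous_const_mul b) hx fun y hy => ?_
    refine Submodule.span_induction (p := fun z _ => b * z ∈ Submodule.span ℂ _) ?_ ?_ ?_ ?_ hy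
    · rintro z ⟨x, y, s, hs, rfl⟩
      exact Submodule.subset_span ⟨b * x, y, s, hs, by simp only [mul_assoc]⟩
    · rw [mul_zero]; exact zero_mem _
    · intro z w _ _ hz hw
      rw [mul_add]; exact add_mem hz hw
    · intro c z _ hz
      rw [mul_smul_comm]; exact Submodule.smul_mem _ c hz
  mul_mem_right' b x hx := by
    refine map_mem_closure (f := fun z => z * b) (continuous_mul_const b) hx fun y hy => ?_
    refine Submodule.span_induction (p := fun z _ => z * b ∈ Submodule.span ℂ _) ?_ ?_ ?_ ?_ hy
    · rintro z ⟨x, y, s, hs, rfl⟩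
      exact Submodule.subset_span ⟨x, y * b, s, hs, by simp only [mul_assoc]⟩
    · rw [zero_mul]; exact zero_mem _
    · intro z w _ _ hz hw
      rw [add_mul]; exact add_mem hz hw
    · intro c z _ hz
      rw [smul_mul_assoc]; exact Submodule.smul_mem _ c hz
  isClosed' := Submodule.isClosed_topologicalClosure _

theorem coe_mulSpan (S : Set B) : (mulSpan S : Set B)
    = closure (Submodule.span ℂ {z : B | ∃ x y : B, ∃ s ∈ S, z = x * s * y} : Set B) := rfl

theorem mulSpan_ne_bot {S : Set B} {s : B} (hs : s ∈ S) (hs0 : s ≠ 0) : mulSpan S ≠ ⊥ := by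
  intro h
  have h1 : star s * s * star s ∈ mulSpan S :=
    subset_closure (Submodule.subset_span ⟨_, _, s, hs, rfl⟩)
  have h2 : star s * s * star s = 0 := eq_bot_iff.1 h _ h1
  have h3 : star (star s * s) * (star s * s) = 0 := by
    rw [star_mul, star_star, ← mul_assoc, h2, zero_mul]
  rw [CStarRing.star_mul_self_eq_zero_iff, CStarRing.star_mul_self_eq_zero_iff] at h3
  exact hs0 h3

theorem mulSpan_le {S : Set B} {J : ClosedIdeal B} (h : ∀ s ∈ S, s ∈ J) : mulSpan S ≤ J := by
  intro x hx
  refine closure_minimal (s := (Submodule.span ℂ {z : B | ∃ x y : B, ∃ s ∈ S, z = x * s * y} :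
    Set B)) ?_ J.isClosed hx
  have : Submodule.span ℂ {z : B | ∃ x y : B, ∃ s ∈ S, z = x * s * y} ≤ J.toSubmodule :=
    Submodule.span_le.2 fun _ ⟨x, y, s, hs, hz⟩ =>
      hz ▸ J.mul_mem_right _ (J.mul_mem_left _ (h s hs))
  exact this

end ClosedIdeal

variable {A B A' : Type*} [NonUnitalCStarAlgebra A] [NonUnitalCStarAlgebra B]
  [NonUnitalCStarAlgebra A'] {ι : A →⋆ₙₐ[ℂ] B} {j : A →⋆ₙₐ[ℂ] A'}

theorem isMinimal_iff : IsMinimal ι ↔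
    ∀ I : ClosedIdeal A, I ≠ ⊥ → ClosedIdeal.mulSpan (ι '' I) = ⊤ := by
  refine forall₂_congr fun I _ => ?_
  have h : {z : B | ∃ x y : B, ∃ i ∈ I, z = x * ι i * y}
      = {z : B | ∃ x y : B, ∃ s ∈ ι '' I, z = x * s * y} := by
    ext z
    simp [Set.mem_image]
  rw [h, ← ClosedIdeal.coe_mulSpan, Set.eq_univ_iff_forall]
  exact ⟨fun h => SetLike.ext fun x => ⟨fun _ => trivial, fun _ => h x⟩, fun h x => by
    rw [h]; trivial⟩

theorem IsSimple.isMinimal (hι : Function.Injective ι) (hB : IsSimple B) : IsMinimal ι := by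
  rw [isMinimal_iff]
  intro I hI
  refine (hB.2 _).resolve_left ?_
  have : ∃ x ∈ I, x ≠ 0 := by
    by_contra! h
    exact hI (ClosedIdeal.eq_bot_iff.2 h)
  obtain ⟨x, hx, hx0⟩ := this
  exact ClosedIdeal.mulSpan_ne_bot ⟨x, hx, rfl⟩ ((map_ne_zero_iff ι hι).2 hx0)

/-- The ideal `J ∩ A` of `A`. -/
def comapIdeal (ι : A →⋆ₙₐ[ℂ] B) (J : ClosedIdeal B) : ClosedIdeal A where
  carrier := ι ⁻¹' J
  add_mem' {x y} hx hy := by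
    change ι (x + y) ∈ J
    rw [map_add]; exact add_mem hx hy
  zero_mem' := by
    change ι 0 ∈ J
    rw [map_zero]; exact zero_mem J
  smul_mem' c x hx := by
    change ι (c • x) ∈ J
    rw [map_smul]; exact SMulMemClass.smul_mem c hx
  mul_mem_left' b x hx := by
    change ι (b * x) ∈ J
    rw [map_mul]; exact J.mul_mem_left _ hx
  mul_mem_right' b x hx := by
    change ι (x * b) ∈ J
    rw [map_mul]; exact J.mul_mem_right _ hx
  isClosed' := J.isClosed.preimage (continuous_starHom ι)

theorem isSimple_of_isMinimal_of_detectsIdeals [Nontrivial A] (hι : Function.Injective ι)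
    (hmin : IsMinimal ι) (hd : DetectsIdeals ι) : IsSimple B := by
  refine ⟨hι.nontrivial, fun J => or_iff_not_imp_left.2 fun hJ => ?_⟩
  have hI : comapIdeal ι J ≠ ⊥ := fun h => hd J hJ fun a ha => by
    rw [ClosedIdeal.eq_bot_iff.1 h a ha, map_zero]
  have h1 := isMinimal_iff.1 hmin _ hI
  have h2 : ClosedIdeal.mulSpan (ι '' (comapIdeal ι J)) ≤ J :=
    ClosedIdeal.mulSpan_le fun _ ⟨_, ha, has⟩ => has ▸ ha
  rw [h1] at h2
  exact SetLike.ext fun x => ⟨fun _ => trivial, fun _ => h2 (ClosedIdeal.mem_top x)⟩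

variable [PartialOrder B] [StarOrderedRing B] [PartialOrder A'] [StarOrderedRing A']

theorem IsSimple.nullIdeal_eq_bot [Nontrivial A] (hB : IsSimple B) (hι : Function.Injective ι)
    (hj : Function.Injective j) (E : GeneralisedExpectation ι j) : E.nullIdeal = ⊥ := by
  refine (hB.2 _).resolve_right fun h => ?_
  obtain ⟨a, ha⟩ := exists_ne (0 : A)
  refine ha ((map_eq_zero_iff ι hι).1 (E.meetsTrivially_nullIdeal hj a ?_))
  rw [h]
  trivial

theorem isAlmostFaithful_iff (E : GeneralisedExpectation ι j) :
    E.IsAlmostFaithful ↔ E.nullIdeal = ⊥ := by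
  refine ⟨fun h => ClosedIdeal.eq_bot_iff.2 fun b hb => h b fun c => ?_, fun h b hb => ?_⟩
  · exact E.apply_eq_zero_of_mem_nullIdeal
      (E.nullIdeal.mul_mem_left _ (E.nullIdeal.mul_mem_right _ hb))
  · refine ClosedIdeal.eq_bot_iff.1 h b (ClosedIdeal.mem_of_star_mul_self_mem
      (E.mem_nullIdeal_of_forall_conjugate fun c => ?_))
    rw [← hb c, star_mul]
    simp only [mul_assoc]

end Simple

/-! ### Infinite elements of simple C*-algebras -/

theorem tendsto_of_forall_norm_sub_lt {B : Type*} [NormedAddCommGroup B] {f : ℕ → B} {l : B}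
    (h : ∀ k : ℕ, ‖f k - l‖ < 1 / ((k : ℝ) + 1)) : Tendsto f atTop (𝓝 l) :=
  tendsto_iff_norm_sub_tendsto_zero.2
    (squeeze_zero (fun _ => norm_nonneg _) (fun k => (h k).le)
      tendsto_one_div_add_atTop_nhds_zero_nat)

section Infinite

variable {B : Type*} [NonUnitalCStarAlgebra B]

section Order

variable [PartialOrder B]

/-- The approximations in the definition of an infinite element, as sequences. -/
theorem IsInfinite.exists_tendsto {a : B} (ha : IsInfinite a) :
    ∃ b : B, 0 ≤ b ∧ b ≠ 0 ∧ ∃ x y : ℕ → B,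
      Tendsto (fun k => star (a * x k) * (a * x k)) atTop (𝓝 a) ∧
      Tendsto (fun k => star (a * y k) * (a * y k)) atTop (𝓝 b) ∧
      Tendsto (fun k => star (a * x k) * (a * y k)) atTop (𝓝 0) := by
  obtain ⟨-, -, b, hb, hb0, h⟩ := ha
  choose x' hx' y' hy' h1 h2 h3 using fun k : ℕ => h (1 / ((k : ℝ) + 1)) (by positivity)
  choose x hx using hx'
  choose y hy using hy'
  dsimp only at hx hy
  refine ⟨b, hb, hb0, x, y, ?_, ?_, ?_⟩ <;> simp only [hx, hy]
  · exact tendsto_of_forall_norm_sub_lt h1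
  · exact tendsto_of_forall_norm_sub_lt h2
  · exact tendsto_of_forall_norm_sub_lt fun k => by rw [sub_zero]; exact h3 k

/-- A character does not embed a C*-algebra with an infinite element. -/
theorem IsInfinite.not_injective {a : B} (ha : IsInfinite a) (χ : B →⋆ₙₐ[ℂ] ℂ) :
    ¬ Function.Injective χ := by
  intro hχ
  obtain ⟨b, -, hb0, x, y, hx, hy, hxy⟩ := ha.exists_tendsto
  have hc := continuous_starHom χ
  have h1 := (((hc.tendsto _).comp hx).norm).mul (((hc.tendsto _).comp hy).norm)
  have h2 := (((hc.tendsto _).comp hxy).norm).pow 2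
  have h3 := tendsto_nhds_unique h1 (h2.congr fun k => by
    simp only [Function.comp_apply, map_mul, map_star, norm_mul, norm_star]
    ring)
  rw [map_zero, norm_zero, zero_pow two_ne_zero, mul_eq_zero, norm_eq_zero, norm_eq_zero,
    map_eq_zero_iff χ hχ, map_eq_zero_iff χ hχ] at h3
  exact h3.elim ha.2.1 hb0

end Order

theorem norm_sub_lt_eventually {f : ℕ → B} {l m : B} (h : Tendsto f atTop (𝓝 l)) {ε : ℝ}
    (hlm : ‖l - m‖ < ε) : ∀ᶠ k in atTop, ‖f k - m‖ < ε :=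
  ((h.sub_const m).norm).eventually_lt_const hlm

variable [PartialOrder B] [StarOrderedRing B]

/-- For infinite `a` with witness `b`, the right ideal `a B` contains, approximately, any number of
pairwise orthogonal copies of `b`. The elements of `a B` in the definition of infiniteness should be
thought of as `v √a` and `w √b` for isometries `v` and `w` with orthogonal ranges; the induction
step composes such isometries. -/
theorem exists_orthogonal_copies {a b : B} (ha : 0 ≤ a)
    (hab : ∀ ε : ℝ, 0 < ε → ∃ x y : B, ‖star (a * x) * (a * x) - a‖ < ε ∧
      ‖star (a * y) * (a * y) - b‖ < ε ∧ ‖star (a * x) * (a * y)‖ < ε) (n : ℕ) :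
    ∀ ε : ℝ, 0 < ε → ∃ x : B, ∃ y : ℕ → B, ‖star (a * x) * (a * x) - a‖ < ε ∧
      (∀ i < n, ‖star (a * x) * (a * y i)‖ < ε) ∧
      ∀ i < n, ∀ l < n, ‖star (a * y i) * (a * y l) - (if i = l then b else 0)‖ < ε := by
  induction n with
  | zero =>
    intro ε hε
    obtain ⟨x, -, h, -, -⟩ := hab ε hε
    exact ⟨x, 0, h, by simp, by simp⟩
  | succ n ih =>
    intro ε hε
    -- the new elements are `x √a z`, `x √a w` and the old `y`
    set h := CFC.sqrt a with hh
    have hha : h * h = a := CFC.sqrt_mul_sqrt_self a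
    have hhs : star h = h := (CFC.sqrt_nonneg a).isSelfAdjoint
    have has : star a = a := ha.isSelfAdjoint
    obtain ⟨z, w, hz, hw, hzw⟩ := hab ε hε
    choose x y hx hxy hy using fun k : ℕ => ih (1 / ((k : ℝ) + 1)) (by positivity)
    have tx : Tendsto (fun k => star (a * x k) * (a * x k)) atTop (𝓝 a) :=
      tendsto_of_forall_norm_sub_lt hx
    have txy (i : ℕ) (hi : i < n) :
        Tendsto (fun k => star (a * x k) * (a * y k i)) atTop (𝓝 0) :=
      tendsto_of_forall_norm_sub_lt fun k => by rw [sub_zero]; exact hxy k i hi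
    have ty (i l : ℕ) (hi : i < n) (hl : l < n) :
        Tendsto (fun k => star (a * y k i) * (a * y k l)) atTop (𝓝 (if i = l then b else 0)) :=
      tendsto_of_forall_norm_sub_lt fun k => hy k i hi l hl
    have conj (p q : B) : Tendsto (fun k => star (a * (x k * h * p)) * (a * (x k * h * q))) atTop
        (𝓝 (star (a * p) * (a * q))) := by
      have h1 := (tx.const_mul (star p * h)).mul_const (h * q)
      have h2 : star p * h * a * (h * q) = star (a * p) * (a * q) := by
        rw [star_mul, has, ← hha]; noncomm_ring
      rw [h2] at h1
      refine h1.congr fun k => ?_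
      simp only [star_mul, hhs]
      noncomm_ring
    have conjy (p : B) (i : ℕ) (hi : i < n) :
        Tendsto (fun k => star (a * (x k * h * p)) * (a * y k i)) atTop (𝓝 0) := by
      have h1 := (txy i hi).const_mul (star p * h)
      rw [mul_zero] at h1
      refine h1.congr fun k => ?_
      simp only [star_mul, hhs]
      noncomm_ring
    let y' (k i : ℕ) : B := if i < n then y k i else x k * h * w
    have hy'lt (k : ℕ) {i : ℕ} (hi : i < n) : y' k i = y k i := if_pos hi
    have hy'n (k : ℕ) : y' k n = x k * h * w := if_neg (lt_irrefl n)
    have e1 : ∀ᶠ k in atTop, ‖star (a * (x k * h * z)) * (a * (x k * h * z)) - a‖ < ε :=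
      norm_sub_lt_eventually (conj z z) hz
    have e2 : ∀ᶠ k in atTop, ∀ i ∈ Set.Iio (n + 1),
        ‖star (a * (x k * h * z)) * (a * y' k i)‖ < ε := by
      refine (Set.finite_Iio (n + 1)).eventually_all.2 fun i hi => ?_
      rcases Nat.lt_succ_iff_lt_or_eq.1 hi with hi | rfl
      · simp only [hy'lt _ hi]
        simpa using norm_sub_lt_eventually (conjy z i hi) (m := 0) (by simpa using hε)
      · simp only [hy'n]
        simpa using norm_sub_lt_eventually (conj z w) (m := 0) (by simpa using hzw)
    have e3 : ∀ᶠ k in atTop, ∀ i ∈ Set.Iio (n + 1), ∀ l ∈ Set.Iio (n + 1),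
        ‖star (a * y' k i) * (a * y' k l) - (if i = l then b else 0)‖ < ε := by
      refine (Set.finite_Iio (n + 1)).eventually_all.2 fun i hi =>
        (Set.finite_Iio (n + 1)).eventually_all.2 fun l hl => ?_
      rcases Nat.lt_succ_iff_lt_or_eq.1 hi with hi | rfl <;>
        rcases Nat.lt_succ_iff_lt_or_eq.1 hl with hl | rfl
      · simp only [hy'lt _ hi, hy'lt _ hl]
        exact norm_sub_lt_eventually (ty i l hi hl) (by simpa using hε)
      · simp only [hy'lt _ hi, hy'n, if_neg hi.ne]
        refine norm_sub_lt_eventually (l := 0) ?_ (by simpa using hε)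
        simpa using (conjy w i hi).star
      · simp only [hy'lt _ hl, hy'n, if_neg hl.ne']
        exact norm_sub_lt_eventually (conjy w l hl) (by simpa using hε)
      · simp only [hy'n, if_true]
        exact norm_sub_lt_eventually (conj w w) hw
    obtain ⟨k, h1, h2, h3⟩ := (e1.and (e2.and e3)).exists
    exact ⟨_, y' k, h1, h2, h3⟩

/-- If `z = (a s)* (a t)`, then `z* z` is at most a multiple of `t* a t`, hence Cuntz below `a`. -/
theorem cuntzBelow_of_mem_range {a : B} (ha : 0 ≤ a) (s t : B) :
    CuntzBelow (star (star (a * s) * (a * t)) * (star (a * s) * (a * t))) a := by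
  set h := CFC.sqrt a with hh
  have hha : h * h = a := CFC.sqrt_mul_sqrt_self a
  have hhs : star h = h := (CFC.sqrt_nonneg a).isSelfAdjoint
  have has : star a = a := ha.isSelfAdjoint
  set g := star s * a * h with hg
  have h1 : star (star (a * s) * (a * t)) * (star (a * s) * (a * t))
      = star (h * t) * (star g * g) * (h * t) := by
    simp only [hg, star_mul, star_star, has, hhs]
    rw [← hha]; noncomm_ring
  have h2 (r : ℝ) (hr : 0 ≤ r) :
      r • (star (h * t) * (h * t)) = star (√r • t) * a * (√r • t) := by
    rw [star_smul, star_trivial (√r), smul_mul_assoc, smul_mul_assoc, mul_smul_comm, smul_smul,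
      Real.mul_self_sqrt hr, star_mul, hhs, ← hha]
    simp only [mul_assoc]
  refine (cuntzBelow_of_le (star_mul_self_nonneg _) ?_).trans
    (cuntzBelow_conjugate a (√‖star g * g‖ • t))
  rw [h1, ← h2 _ (norm_nonneg _)]
  exact CStarAlgebra.star_left_conjugate_le_norm_smul (IsSelfAdjoint.star_mul_self g)

/-- In a simple C*-algebra, an infinite element dominates every positive element. -/
theorem IsInfinite.cuntzBelow {a : B} (ha : IsInfinite a) (hB : IsSimple B) {d : B} (hd : 0 ≤ d) :
    CuntzBelow d a := by
  obtain ⟨ha0, -, b, -, hb0, h⟩ := ha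
  have hab : ∀ ε : ℝ, 0 < ε → ∃ x y : B, ‖star (a * x) * (a * x) - a‖ < ε ∧
      ‖star (a * y) * (a * y) - b‖ < ε ∧ ‖star (a * x) * (a * y)‖ < ε := fun ε hε => by
    obtain ⟨_, ⟨x, rfl⟩, _, ⟨y, rfl⟩, h⟩ := h ε hε
    exact ⟨x, y, h⟩
  -- `s = ∑ cᵢ uᵢ b vᵢ` is the limit of `(a S)* (a T)`, where `S = ∑ yᵢ (cᵢ uᵢ)*` and `T = ∑ yᵢ vᵢ`
  have key : ∀ s ∈ Submodule.span ℂ {z : B | ∃ x y : B, ∃ s ∈ ({b} : Set B), z = x * s * y},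
      CuntzBelow (star s * s) a := by
    intro s hs
    obtain ⟨n, c, g, hs⟩ := Submodule.mem_span_set'.1 hs
    choose u v b' hb' hg using fun i => (g i).2
    choose _ y _ _ hy using fun k : ℕ =>
      exists_orthogonal_copies ha0 hab n (1 / ((k : ℝ) + 1)) (by positivity)
    have ty (i l : Fin n) : Tendsto (fun k => star (a * y k i) * (a * y k l)) atTop
        (𝓝 (if i = l then b else 0)) :=
      tendsto_of_forall_norm_sub_lt fun k => by
        simpa only [Fin.val_inj] using hy k i i.2 l l.2
    set S : ℕ → B := fun k => ∑ i : Fin n, y k i * star (c i • u i)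
    set T : ℕ → B := fun k => ∑ i : Fin n, y k i * v i
    have hST : Tendsto (fun k => star (a * S k) * (a * T k)) atTop (𝓝 s) := by
      have h1 : Tendsto (fun k => ∑ i : Fin n, ∑ l : Fin n,
          (c i • u i) * (star (a * y k i) * (a * y k l)) * v l) atTop
          (𝓝 (∑ i : Fin n, ∑ l : Fin n, (c i • u i) * (if i = l then b else 0) * v l)) :=
        tendsto_finsetSum _ fun i _ => tendsto_finsetSum _ fun l _ =>
          ((ty i l).const_mul _).mul_const _
      have h2 : (∑ i : Fin n, ∑ l : Fin n, (c i • u i) * (if i = l then b else 0) * v l) = s := by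
        rw [← hs]
        refine Finset.sum_congr rfl fun i _ => ?_
        rw [Finset.sum_eq_single i (fun l _ hl => by rw [if_neg hl.symm, mul_zero, zero_mul])
          (by simp), if_pos rfl, hg i, show b' i = b from hb' i, smul_mul_assoc, smul_mul_assoc]
      rw [h2] at h1
      refine h1.congr fun k => ?_
      simp only [S, T, Finset.mul_sum, Finset.sum_mul, star_sum, star_mul, star_star]
      rw [Finset.sum_comm]
      refine Finset.sum_congr rfl fun i _ => Finset.sum_congr rfl fun l _ => ?_
      simp only [mul_assoc]
    refine cuntzBelow_of_approx fun ε hε => ?_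
    obtain ⟨k, hk⟩ := (norm_sub_lt_eventually (hST.star.mul hST) (m := star s * s) (ε := ε)
      (by simpa using hε)).exists
    exact ⟨_, cuntzBelow_of_mem_range ha0 (S k) (T k), by rwa [norm_sub_rev]⟩
  obtain ⟨q, rfl⟩ := CStarAlgebra.nonneg_iff_eq_star_mul_self.1 hd
  have hq : q ∈ ClosedIdeal.mulSpan ({b} : Set B) := by
    rw [(hB.2 _).resolve_left (ClosedIdeal.mulSpan_ne_bot (Set.mem_singleton b) hb0)]
    trivial
  obtain ⟨s, hs, hsq⟩ := mem_closure_iff_seq_limit.1 hq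
  refine cuntzBelow_of_approx fun ε hε => ?_
  obtain ⟨k, hk⟩ := (norm_sub_lt_eventually (hsq.star.mul hsq) (m := star q * q) (ε := ε)
    (by simpa using hε)).exists
  exact ⟨_, key _ (hs k), by rwa [norm_sub_rev]⟩

end Infinite

/-! ### Infinite elements of purely infinite simple C*-algebras -/

section PurelyInfinite

variable {B : Type*} [NonUnitalCStarAlgebra B]

/-- If `B = p B p` is spanned by a projection `p`, then `B` has a character. -/
theorem exists_character_of_forall_eq_smul {p : B} (hp0 : p ≠ 0) (hps : IsSelfAdjoint p)
    (hpp : p * p = p) (h : ∀ b : B, ∃ c : ℂ, b = c • p) : ∃ χ : B →⋆ₙₐ[ℂ] ℂ, χ ≠ 0 := by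
  choose c hc using h
  have huniq {x : B} {s : ℂ} (hx : x = s • p) : c x = s :=
    smul_left_injective ℂ hp0 ((hc x).symm.trans hx)
  let χ : B →⋆ₙₐ[ℂ] ℂ :=
    { toFun := c
      map_smul' := fun s x => huniq (by
        rw [smul_assoc]
        exact congrArg (s • ·) (hc x))
      map_zero' := huniq (zero_smul ℂ p).symm
      map_add' := fun x y => huniq (by rw [add_smul, ← hc, ← hc])
      map_mul' := fun x y => huniq (by
        nth_rewrite 1 [hc x, hc y]
        rw [smul_mul_smul_comm, hpp])
      map_star' := fun x => huniq (by
        nth_rewrite 1 [hc x]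
        rw [star_smul, hps.star_eq]) }
  refine ⟨χ, fun h0 => ?_⟩
  have h1 : c p = 1 := huniq (one_smul ℂ p).symm
  have h2 : c p = 0 := DFunLike.congr_fun h0 p
  exact one_ne_zero (h1.symm.trans h2)

/-- A minimal projection `p` does not dominate `p + h` for a nonzero `h` orthogonal to `p`. -/
theorem not_cuntzBelow_add_of_orthogonal {p h : B} (hp0 : p ≠ 0) (hps : IsSelfAdjoint p)
    (hpp : p * p = p) (hmin : ∀ b : B, ∃ c : ℂ, p * b * p = c • p) (hh : IsSelfAdjoint h)
    (hh0 : h ≠ 0) (hph : p * h = 0) : ¬ CuntzBelow (p + h) p := by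
  intro hc
  have hps' := hps.star_eq
  have hhs := hh.star_eq
  have hhp : h * p = 0 := by
    have := congrArg star hph
    rwa [star_mul, hps', hhs, star_zero] at this
  choose x hx using fun k : ℕ => hc (1 / ((k : ℝ) + 1)) (by positivity)
  have hlim : Tendsto (fun k => star (x k) * p * x k) atTop (𝓝 (p + h)) :=
    tendsto_of_forall_norm_sub_lt fun k => by rw [norm_sub_rev]; exact hx k
  have conj (u v : B) : Tendsto (fun k => star (p * x k * u) * (p * x k * v)) atTop
      (𝓝 (star u * (p + h) * v)) := by
    refine ((hlim.const_mul (star u)).mul_const v).congr fun k => ?_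
    calc _ = star u * star (x k) * p * x k * v := by simp only [mul_assoc]
      _ = star u * star (x k) * (p * p) * x k * v := by rw [hpp]
      _ = _ := by simp only [star_mul, hps', mul_assoc]
  -- `p x p` is a multiple of `p`, so `‖p x p‖ ‖p x h‖` equals `‖p‖ ‖(p x p)* (p x h)‖`; the first
  -- tends to a nonzero limit and the second to zero
  have h1 := (conj p p).norm
  have h2 := (conj h h).norm
  have h3 := ((conj p h).norm.pow 2).const_mul (‖p‖ ^ 2)
  have h4 := tendsto_nhds_unique (h1.mul h2) (h3.congr fun k => by
    obtain ⟨c, hck⟩ := hmin (x k)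
    have h5 : star (c • p) * (p * x k * h) = star c • (p * x k * h) := by
      rw [star_smul, hps', smul_mul_assoc, ← mul_assoc, ← mul_assoc, hpp]
    rw [hck, h5, CStarRing.norm_star_mul_self, CStarRing.norm_star_mul_self, norm_smul, norm_smul,
      norm_star]
    ring)
  have h6 : star p * (p + h) * h = 0 := by
    rw [hps', mul_add, hph, add_zero, hpp, hph]
  have h7 : star p * (p + h) * p = p := by
    rw [hps', mul_add, hph, add_zero, hpp, hpp]
  have h8 : star h * (p + h) * h = h * h * h := by
    rw [hhs, mul_add, hhp, zero_add]
  rw [h6, h7, h8, norm_cube_of_isSelfAdjoint hh, norm_zero, zero_pow two_ne_zero, mul_zero,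
    mul_eq_zero, norm_eq_zero, pow_eq_zero_iff three_ne_zero, norm_eq_zero] at h4
  exact h4.elim hp0 hh0

variable [PartialOrder B]

theorem IsSimple.cuntzBelow_of_isPurelyInfinite (hB : IsSimple B) (hpi : IsPurelyInfinite B)
    {a b : B} (ha : 0 ≤ a) (hb : 0 ≤ b) (hb0 : b ≠ 0) : CuntzBelow a b :=
  hpi.2 a b ha hb fun J hbJ => by
    rcases hB.2 J with rfl | rfl
    · exact absurd hbJ hb0
    · trivial

variable [StarOrderedRing B]

/-- If `u` is order comparable with all real multiples of `v`, then it is one of them, because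
`ℝ` is connected. -/
theorem exists_eq_smul_of_forall_comparable {u v : B} {M : ℝ} (h1 : u ≤ M • v)
    (h2 : (-M) • v ≤ u) (h : ∀ t : ℝ, t • v ≤ u ∨ u ≤ t • v) : ∃ t : ℝ, u = t • v := by
  have hc : Continuous fun t : ℝ => t • v := by fun_prop
  obtain ⟨t, -, ht1, ht2⟩ := isPreconnected_closed_iff.1 (isPreconnected_univ (α := ℝ))
    {t | t • v ≤ u} {t | u ≤ t • v} (isClosed_le hc continuous_const)
    (isClosed_le continuous_const hc) (fun t _ => h t) ⟨-M, trivial, h2⟩ ⟨M, trivial, h1⟩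
  exact ⟨t, le_antisymm ht2 ht1⟩

/-- A corner in which every self-adjoint element is positive or negative is spanned by a
projection. -/
theorem exists_projection_of_forall_comparable {a : B} (ha : 0 ≤ a) (ha0 : a ≠ 0)
    (h : ∀ z : B, IsSelfAdjoint z → 0 ≤ a * z * a ∨ a * z * a ≤ 0) :
    ∃ p : B, p ≠ 0 ∧ IsSelfAdjoint p ∧ p * p = p ∧ ∀ b : B, ∃ c : ℂ, p * b * p = c • p := by
  have has : star a = a := ha.isSelfAdjoint
  obtain ⟨t, ht⟩ : ∃ t : ℝ, a * a * a * a = t • (a * a * a) := by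
    set r := CFC.sqrt a with hr
    have hra : r * r = a := CFC.sqrt_mul_sqrt_self a
    have hrs : star r = r := (CFC.sqrt_nonneg a).isSelfAdjoint
    have hv : 0 ≤ a * a * a := by
      have := star_left_conjugate_nonneg ha a
      rwa [has] at this
    have hu : 0 ≤ a * a * a * a := by
      have := star_mul_self_nonneg (a * a)
      rwa [star_mul, has, ← mul_assoc] at this
    refine exists_eq_smul_of_forall_comparable (M := ‖a‖) ?_ ?_ fun t => ?_
    · have := CStarAlgebra.star_left_conjugate_le_norm_smul (a := r * a) (b := a)
      rw [star_mul, has, hrs] at this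
      convert this using 1
      · rw [← hra]; noncomm_ring
      · congr 1
        rw [← hra]; noncomm_ring
    · rw [neg_smul]
      exact (neg_nonpos.2 (smul_nonneg (norm_nonneg a) hv)).trans hu
    · have hz : IsSelfAdjoint (a * a - t • a) := by
        rw [IsSelfAdjoint, star_sub, star_smul, star_mul, has, star_trivial t]
      have he : a * (a * a - t • a) * a = a * a * a * a - t • (a * a * a) := by
        rw [mul_sub, sub_mul, mul_smul_comm, smul_mul_assoc]
        simp only [mul_assoc]
      have := h _ hz
      rwa [he, sub_nonneg, sub_nonpos] at this
  -- `w = a² - t a` satisfies `a² w = 0`, hence `a w = 0`, hence `w = 0`.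
  have haw : a * (a * a - t • a) = 0 := by
    rw [← CStarRing.star_mul_self_eq_zero_iff]
    have h1 : a * a * (a * a - t • a) = 0 := by
      rw [mul_sub, mul_smul_comm, ← mul_assoc, ht, sub_self]
    calc _ = star (a * a - t • a) * (a * a * (a * a - t • a)) := by
          rw [star_mul, has]; simp only [mul_assoc]
      _ = 0 := by rw [h1, mul_zero]
  have hw : a * a = t • a := by
    rw [← sub_eq_zero, ← CStarRing.star_mul_self_eq_zero_iff]
    calc _ = a * (a * (a * a - t • a)) - t • (a * (a * a - t • a)) := by
          rw [star_sub, star_smul, star_mul, has, star_trivial t, sub_mul, smul_mul_assoc,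
            mul_assoc]
      _ = 0 := by rw [haw, mul_zero, smul_zero, sub_zero]
  have ht0 : t ≠ 0 := by
    rintro rfl
    rw [zero_smul] at hw
    nth_rewrite 1 [← has] at hw
    exact ha0 (CStarRing.star_mul_self_eq_zero_iff a |>.1 hw)
  set p := t⁻¹ • a with hp
  have hps : IsSelfAdjoint p := by rw [IsSelfAdjoint, hp, star_smul, has, star_trivial t⁻¹]
  have hpp : p * p = p := by
    rw [hp, smul_mul_assoc, mul_smul_comm, hw, inv_smul_smul₀ ht0]
  have hsa (z : B) (hz : IsSelfAdjoint z) : ∃ s : ℝ, p * z * p = s • p := by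
    have hb (z : B) (hz : IsSelfAdjoint z) : p * z * p ≤ ‖z‖ • p := by
      have := CStarAlgebra.star_left_conjugate_le_norm_smul (a := p) (b := z)
      rwa [hps.star_eq, hpp] at this
    refine exists_eq_smul_of_forall_comparable (M := ‖z‖) (hb z hz) ?_ fun s => ?_
    · have := hb (-z) hz.neg
      rw [norm_neg, mul_neg, neg_mul, neg_le] at this
      rwa [neg_smul]
    · have h1 : IsSelfAdjoint ((t⁻¹ * t⁻¹) • (z - s • p)) := by
        rw [IsSelfAdjoint, star_smul, star_sub, star_smul, hz.star_eq, hps.star_eq, star_trivial s,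
          star_trivial (t⁻¹ * t⁻¹)]
      have h2 : a * ((t⁻¹ * t⁻¹) • (z - s • p)) * a = p * z * p - s • p := by
        calc _ = p * (z - s • p) * p := by
              simp only [hp, mul_smul_comm, smul_mul_assoc, smul_smul]
          _ = p * z * p - s • (p * p * p) := by
              rw [mul_sub, sub_mul, mul_smul_comm s p p, smul_mul_assoc s]
          _ = _ := by rw [hpp, hpp]
      have := h _ h1
      rwa [h2, sub_nonneg, sub_nonpos] at this
  refine ⟨p, smul_ne_zero (inv_ne_zero ht0) ha0, hps, hpp, fun b => ?_⟩
  obtain ⟨s₁, hs₁⟩ := hsa _ (realPart b).2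
  obtain ⟨s₂, hs₂⟩ := hsa _ (imaginaryPart b).2
  refine ⟨s₁ + Complex.I * s₂, ?_⟩
  conv_lhs => rw [← realPart_add_I_smul_imaginaryPart b]
  rw [mul_add, add_mul, mul_smul_comm Complex.I p, smul_mul_assoc Complex.I, hs₁, hs₂, add_smul,
    mul_smul, Complex.coe_smul, Complex.coe_smul]

/-- In a purely infinite simple C*-algebra every nonzero positive element `a` is infinite. If some
self-adjoint `k` in `a B a` has nonzero positive and negative parts, then two copies of `a` are
found below these orthogonal elements. Otherwise the corner of `a` is spanned by a minimal
projection, which contradicts pure infiniteness. -/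
theorem IsSimple.isInfinite_of_isPurelyInfinite (hB : IsSimple B) (hpi : IsPurelyInfinite B)
    {a : B} (ha : 0 ≤ a) (ha0 : a ≠ 0) : IsInfinite a := by
  have has : star a = a := ha.isSelfAdjoint
  by_cases h : ∀ z : B, IsSelfAdjoint z → 0 ≤ a * z * a ∨ a * z * a ≤ 0
  · exfalso
    obtain ⟨p, hp0, hps, hpp, hmin⟩ := exists_projection_of_forall_comparable ha ha0 h
    have hpnn : 0 ≤ p := by
      have := star_mul_self_nonneg p
      rwa [hps.star_eq, hpp] at this
    by_cases hb : ∀ b : B, b * p = b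
    · have hb' (b : B) : p * b = b := by
        have := congrArg star (hb (star b))
        rwa [star_mul, star_star, hps.star_eq] at this
      obtain ⟨χ, hχ⟩ := exists_character_of_forall_eq_smul hp0 hps hpp fun b => by
        obtain ⟨c, hc⟩ := hmin b
        exact ⟨c, by rw [← hc, hb', hb]⟩
      exact hχ (hpi.1 χ)
    · push Not at hb
      obtain ⟨b, hb⟩ := hb
      have hc0 : b - b * p ≠ 0 := fun h => hb (sub_eq_zero.1 h).symm
      have hcp : (b - b * p) * p = 0 := by rw [sub_mul, mul_assoc, hpp, sub_self]
      refine not_cuntzBelow_add_of_orthogonal (h := star (b - b * p) * (b - b * p)) hp0 hps hpp hmin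
        (IsSelfAdjoint.star_mul_self _) (by rwa [Ne, CStarRing.star_mul_self_eq_zero_iff]) ?_ ?_
      · have := congrArg star hcp
        rw [star_mul, hps.star_eq, star_zero] at this
        rw [← mul_assoc, this, zero_mul]
      · exact hB.cuntzBelow_of_isPurelyInfinite hpi
          (add_nonneg hpnn (star_mul_self_nonneg _)) hpnn hp0
  · push Not at h
    obtain ⟨z, hz, h1, h2⟩ := h
    set k := a * z * a with hk
    have hks : IsSelfAdjoint k := by
      rw [IsSelfAdjoint, hk, star_mul, star_mul, has, hz.star_eq, mul_assoc]
    have hp0 : k⁺ ≠ 0 := fun h => h2 ((CFC.posPart_eq_zero_iff k).1 h)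
    have hn0 : k⁻ ≠ 0 := fun h => h1 ((CFC.negPart_eq_zero_iff k).1 h)
    have hps : star k⁺ = k⁺ := (CFC.posPart_nonneg k).isSelfAdjoint
    have hns : star k⁻ = k⁻ := (CFC.negPart_nonneg k).isSelfAdjoint
    have hpn : k⁺ * k⁻ = 0 := CFC.posPart_mul_negPart k
    have hpk : k⁺ * k⁺ = a * (z * a * k⁺) := by
      calc k⁺ * k⁺ = (k⁺ - k⁻) * k⁺ := by rw [sub_mul, CFC.negPart_mul_posPart, sub_zero]
        _ = k * k⁺ := by rw [CFC.posPart_sub_negPart k]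
        _ = _ := by rw [hk]; simp only [mul_assoc]
    have hnk : k⁻ * k⁻ = a * (-(z * a * k⁻)) := by
      calc k⁻ * k⁻ = -((k⁺ - k⁻) * k⁻) := by rw [sub_mul, hpn, zero_sub, neg_neg]
        _ = -(k * k⁻) := by rw [CFC.posPart_sub_negPart k]
        _ = _ := by rw [hk, mul_neg]; simp only [mul_assoc]
    have hsq {q : B} (hqs : star q = q) (hq0 : q ≠ 0) : star (q * q) * (q * q) ≠ 0 := by
      rw [Ne, CStarRing.star_mul_self_eq_zero_iff]
      nth_rewrite 1 [← hqs]
      rwa [CStarRing.star_mul_self_eq_zero_iff]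
    refine ⟨ha, ha0, a, ha, ha0, fun ε hε => ?_⟩
    obtain ⟨u, hu⟩ := hB.cuntzBelow_of_isPurelyInfinite hpi ha (star_mul_self_nonneg (k⁺ * k⁺))
      (hsq hps hp0) ε hε
    obtain ⟨v, hv⟩ := hB.cuntzBelow_of_isPurelyInfinite hpi ha (star_mul_self_nonneg (k⁻ * k⁻))
      (hsq hns hn0) ε hε
    refine ⟨k⁺ * k⁺ * u, ⟨z * a * k⁺ * u, ?_⟩, k⁻ * k⁻ * v, ⟨-(z * a * k⁻) * v, ?_⟩, ?_, ?_, ?_⟩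
    · rw [hpk]; simp only [mul_assoc]
    · rw [hnk]; simp only [mul_assoc]
    · rw [norm_sub_rev]
      simpa only [star_mul, mul_assoc] using hu
    · rw [norm_sub_rev]
      simpa only [star_mul, mul_assoc] using hv
    · have : star (k⁺ * k⁺ * u) * (k⁻ * k⁻ * v) = star u * k⁺ * (k⁺ * k⁻) * (k⁻ * v) := by
        simp only [star_mul, hps, mul_assoc]
      rw [this, hpn, mul_zero, zero_mul, norm_zero]
      exact hε

/-- A simple C*-algebra is purely infinite if each nonzero positive element dominates an infinite
one. -/
theorem IsSimple.isPurelyInfinite (hB : IsSimple B)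
    (h : ∀ b : B, 0 ≤ b → b ≠ 0 → ∃ a : B, IsInfinite a ∧ CuntzBelow a b) :
    IsPurelyInfinite B := by
  refine ⟨fun χ => ?_, fun a b ha hb hab => ?_⟩
  · by_contra hχ
    have := hB.1
    obtain ⟨b, hb⟩ := exists_ne (0 : B)
    obtain ⟨a, ha, -⟩ := h (star b * b) (star_mul_self_nonneg b)
      (by rwa [Ne, CStarRing.star_mul_self_eq_zero_iff])
    have hker : kerIdeal χ = ⊥ := (hB.2 _).resolve_right fun h => hχ <|
      NonUnitalStarAlgHom.ext fun x => show x ∈ kerIdeal χ by rw [h]; trivial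
    exact ha.not_injective χ ((injective_iff_map_eq_zero χ).2 (ClosedIdeal.eq_bot_iff.1 hker))
  · by_cases hb0 : b = 0
    · obtain rfl : a = 0 := hab ⊥ hb0
      exact cuntzBelow_zero b
    · obtain ⟨c, hc, hcb⟩ := h b hb hb0
      exact (hc.cuntzBelow hB ha).trans hcb

end PurelyInfinite

/-! ### Essentially defined conditional expectations are supportive -/

section Local

open scoped MultiplierAlgebra

section Annihilator

variable {A M : Type*} [NonUnitalCStarAlgebra A] [NonUnitalCStarAlgebra M]

/-- The elements of `A` that are orthogonal to the self-adjoint element `k` of `M`. -/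
def annihilator (κ : A →⋆ₙₐ[ℂ] M) {k : M} (hk : IsSelfAdjoint k) : NonUnitalStarSubalgebra ℂ A where
  carrier := {x | k * κ x = 0 ∧ κ x * k = 0}
  add_mem' hx hy := ⟨by rw [map_add, mul_add, hx.1, hy.1, add_zero],
    by rw [map_add, add_mul, hx.2, hy.2, add_zero]⟩
  zero_mem' := ⟨by rw [map_zero, mul_zero], by rw [map_zero, zero_mul]⟩
  mul_mem' hx hy := ⟨by rw [map_mul, ← mul_assoc, hx.1, zero_mul],
    by rw [map_mul, mul_assoc, hy.2, mul_zero]⟩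
  smul_mem' c x hx := ⟨by rw [map_smul, mul_smul_comm, hx.1, smul_zero],
    by rw [map_smul, smul_mul_assoc, hx.2, smul_zero]⟩
  star_mem' {x} hx := by
    have h1 := congrArg star hx.1
    have h2 := congrArg star hx.2
    rw [star_mul, hk.star_eq, star_zero, ← map_star] at h1 h2
    exact ⟨h2, h1⟩

theorem isHereditary_annihilator [PartialOrder A] [StarOrderedRing A] (κ : A →⋆ₙₐ[ℂ] M) {k : M}
    (hk : IsSelfAdjoint k) : IsHereditary (annihilator κ hk) := by
  have hκ := continuous_starHom κ
  refine ⟨?_, fun a d ha had hd => ?_⟩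
  · exact (isClosed_eq (continuous_const.mul hκ) continuous_const).inter
      (isClosed_eq (hκ.mul continuous_const) continuous_const)
  · let := CStarAlgebra.spectralOrder M
    have := CStarAlgebra.spectralOrderedRing M
    obtain ⟨s, rfl⟩ := CStarAlgebra.nonneg_iff_eq_star_mul_self.1 ha
    have h1 : star k * κ (star s * s) * k ≤ star k * κ d * k :=
      star_left_conjugate_le_conjugate (OrderHomClass.mono κ had) k
    have h2 : star k * κ (star s * s) * k = star (κ s * k) * (κ s * k) := by
      rw [map_mul, map_star, star_mul]
      simp only [mul_assoc]
    rw [mul_assoc, mul_assoc, hd.2, mul_zero, ← mul_assoc, h2] at h1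
    have h3 := le_antisymm h1 (star_mul_self_nonneg _)
    rw [CStarRing.star_mul_self_eq_zero_iff] at h3
    have h4 := congrArg star h3
    rw [star_mul, hk.star_eq, star_zero, ← map_star] at h4
    exact ⟨by rw [map_mul, ← mul_assoc, h4, zero_mul], by rw [map_mul, mul_assoc, h3, mul_zero]⟩

end Annihilator

theorem le_norm_conjugate_of_mul_eq_zero {M : Type*} [CStarAlgebra M] [PartialOrder M]
    [StarOrderedRing M] {y c k : M} {t : ℝ} (ht : 0 ≤ t) (hy : IsSelfAdjoint y) (hy1 : ‖y‖ = 1)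
    (hc : 0 ≤ c) (hk : k * y = 0) : t ≤ ‖y * (algebraMap ℝ M t + (c - k)) * y‖ := by
  have h1 : y * (algebraMap ℝ M t + (c - k)) * y = t • (y * y) + y * c * y := by
    rw [mul_add, add_mul, mul_sub, sub_mul, mul_assoc y k, hk, mul_zero, sub_zero,
      Algebra.algebraMap_eq_smul_one, mul_smul_comm, smul_mul_assoc, mul_one]
  have h2 : 0 ≤ y * y := by
    have := star_mul_self_nonneg y
    rwa [hy.star_eq] at this
  have h3 : 0 ≤ y * c * y := by
    have := star_left_conjugate_nonneg hc y
    rwa [hy.star_eq] at this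
  have h4 : ‖y * y‖ = 1 := by
    have := CStarRing.norm_star_mul_self (x := y)
    rwa [hy.star_eq, hy1, mul_one] at this
  rw [h1]
  calc t = ‖t • (y * y)‖ := by rw [norm_smul, h4, mul_one, Real.norm_eq_abs, abs_of_nonneg ht]
    _ ≤ _ := CStarAlgebra.norm_le_norm_of_nonneg_of_le (smul_nonneg ht h2)
      (le_add_of_nonneg_right h3)

variable {A : Type*} [NonUnitalCStarAlgebra A]

/-- The canonical homomorphism `M(I) → M_loc(A)`. -/
noncomputable def ofMultiplier (I : EssentialIdeal A) :
    𝓜(ℂ, I.ideal) →⋆ₐ[ℂ] LocalMultiplierAlgebra A where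
  toFun m := LocalMultiplierAlgebra.incl (AlgLocalMultiplier.of I m)
  map_one' := by rw [AlgLocalMultiplier.of_one, map_one]
  map_mul' m n := by rw [AlgLocalMultiplier.of_mul, map_mul]
  map_zero' := by rw [AlgLocalMultiplier.of_zero, map_zero]
  map_add' m n := by rw [AlgLocalMultiplier.of_add, map_add]
  commutes' c := by
    rw [Algebra.algebraMap_eq_smul_one, AlgLocalMultiplier.of_smul, AlgLocalMultiplier.of_one,
      map_smul, map_one, Algebra.algebraMap_eq_smul_one]
  map_star' m := by rw [AlgLocalMultiplier.of_star, LocalMultiplierAlgebra.incl_star]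

theorem norm_ofMultiplier (I : EssentialIdeal A) (m : 𝓜(ℂ, I.ideal)) :
    ‖ofMultiplier I m‖ = ‖m‖ :=
  LocalMultiplierAlgebra.norm_incl _

theorem AlgLocalMultiplier.of_transition {I J : EssentialIdeal A} (h : I ≤ J) (m : 𝓜(ℂ, I.ideal)) :
    AlgLocalMultiplier.of J (transition A I J h m) = AlgLocalMultiplier.of I m :=
  DirectLimit.mk_apply (F := fun I : EssentialIdeal A => 𝓜(ℂ, I.ideal))
    (f := fun _ _ h => transition A _ _ h) I J m h

theorem embedding_eq_ofMultiplier (I : EssentialIdeal A) (a : A) :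
    LocalMultiplierAlgebra.embedding A a
      = ofMultiplier I (ClosedIdeal.toMultiplier I.ideal a) := by
  have h : (⟨⊤, ClosedIdeal.isEssential_top⟩ : EssentialIdeal A) ≤ I := fun _ _ => trivial
  exact congrArg LocalMultiplierAlgebra.incl (AlgLocalMultiplier.of_transition h
    (ClosedIdeal.toMultiplier (⊤ : ClosedIdeal A) a)).symm

/-- In `M_loc(A)`, a multiplier of `I` acts on `I ⊆ A` as it does on `I`. -/
theorem ofMultiplier_mul_embedding (I : EssentialIdeal A) (m : 𝓜(ℂ, I.ideal)) (y : I.ideal) :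
    ofMultiplier I m * LocalMultiplierAlgebra.embedding A y
      = LocalMultiplierAlgebra.embedding A (m.fst y : A) := by
  rw [embedding_eq_ofMultiplier I, embedding_eq_ofMultiplier I, ← map_mul]
  congr 1
  rw [← sub_eq_zero, ← norm_eq_zero, ← DoubleCentralizer.norm_fst, norm_eq_zero]
  ext x
  change ((m.fst (y * x) - m.fst y * x : I.ideal) : A) = 0
  rw [ClosedIdeal.coe_fst_mul, sub_self]
  rfl

theorem exists_ofMultiplier_norm_sub_lt {m : LocalMultiplierAlgebra A}
    (hm : ∃ w, m = star w * w) {ε : ℝ} (hε : 0 < ε) :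
    ∃ (I : EssentialIdeal A) (v : 𝓜(ℂ, I.ideal)), ‖m - ofMultiplier I (star v * v)‖ < ε := by
  obtain ⟨w, rfl⟩ := hm
  have ho : IsOpen {z : LocalMultiplierAlgebra A | ‖star w * w - star z * z‖ < ε} :=
    isOpen_lt (by fun_prop) continuous_const
  obtain ⟨v, hv⟩ := LocalMultiplierAlgebra.denseRange_incl.exists_mem_open ho
    ⟨w, by simpa using hε⟩
  obtain ⟨I, v, rfl⟩ := AlgLocalMultiplier.exists_of v
  exact ⟨I, v, by rw [map_mul, map_star]; exact hv⟩

/-- Nonzero positive local multipliers are bounded below on a nonzero hereditary subalgebra of `A`.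
Approximate `m` by a positive multiplier `μ` of an essential ideal `I`; on the elements of `A`
orthogonal to `(μ - t)₋` the multiplier `μ` is at least `t`. -/
theorem exists_isHereditary_le_norm [PartialOrder A] [StarOrderedRing A]
    {m : LocalMultiplierAlgebra A} (hm : ∃ w, m = star w * w) (hm0 : m ≠ 0) :
    ∃ δ : ℝ, 0 < δ ∧ ∃ D : NonUnitalStarSubalgebra ℂ A, IsHereditary D ∧ D ≠ ⊥ ∧
      ∀ x ∈ D, 0 ≤ x → ‖x‖ = 1 → δ ≤
        ‖LocalMultiplierAlgebra.embedding A x * m * LocalMultiplierAlgebra.embedding A x‖ := by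
  have hpos : 0 < ‖m‖ := norm_pos_iff.2 hm0
  obtain ⟨I, v, hv⟩ := exists_ofMultiplier_norm_sub_lt hm (ε := ‖m‖ / 4) (by positivity)
  let := CStarAlgebra.spectralOrder 𝓜(ℂ, I.ideal)
  have := CStarAlgebra.spectralOrderedRing 𝓜(ℂ, I.ideal)
  let := CStarAlgebra.spectralOrder (LocalMultiplierAlgebra A)
  have := CStarAlgebra.spectralOrderedRing (LocalMultiplierAlgebra A)
  set t : ℝ := ‖m‖ / 2 with ht
  have ht0 : 0 < t := by positivity
  set μ := star v * v with hμ
  have hμ0 : 0 ≤ μ := star_mul_self_nonneg v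
  set q := μ - algebraMap ℝ _ t with hq
  have hqs : IsSelfAdjoint q := hμ0.isSelfAdjoint.sub (IsSelfAdjoint.algebraMap _ (.all t))
  have hμq : μ = algebraMap ℝ _ t + (q⁺ - q⁻) := by
    rw [CFC.posPart_sub_negPart q, hq]; abel
  set κ := LocalMultiplierAlgebra.embedding A
  set θ := ofMultiplier I
  have hθ : θ μ = algebraMap ℝ _ t + (θ q⁺ - θ q⁻) := by
    rw [hμq, map_add, map_sub]
    congr 1
    exact AlgHomClass.commutes (θ.restrictScalars ℝ) t
  have hk : IsSelfAdjoint (θ q⁻) := (CFC.negPart_nonneg q).isSelfAdjoint.map θ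
  have hc : 0 ≤ θ q⁺ := map_nonneg θ (CFC.posPart_nonneg q)
  refine ⟨t / 2, by positivity, annihilator κ hk, isHereditary_annihilator κ hk, ?_,
    fun x hx hx0 hx1 => ?_⟩
  · -- `q₊` is nonzero, since `μ ≤ t` would contradict the size of `μ`
    have hq0 : q⁺ ≠ 0 := by
      intro h
      have h1 : μ ≤ algebraMap ℝ _ t :=
        sub_nonpos.1 ((CFC.posPart_eq_zero_iff q).1 h)
      have h2 := (CStarAlgebra.norm_le_iff_le_algebraMap μ ht0.le).2 h1
      have h3 := norm_le_norm_add_norm_sub' m (θ μ)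
      rw [norm_ofMultiplier] at h3
      linarith
    have : ∃ y : I.ideal, q⁺.fst y ≠ 0 := by
      by_contra! h
      refine hq0 ?_
      rw [← norm_eq_zero, ← DoubleCentralizer.norm_fst, norm_eq_zero]
      ext y
      simp [h]
    obtain ⟨y, hy⟩ := this
    obtain ⟨z, hz⟩ : ∃ z : A, z = (q⁺.fst y : I.ideal) := ⟨_, rfl⟩
    have hzκ : κ z = θ q⁺ * κ y := by
      rw [hz]
      exact (ofMultiplier_mul_embedding I _ y).symm
    have hkz : θ q⁻ * κ z = 0 := by
      rw [hzκ, ← mul_assoc, ← map_mul, CFC.negPart_mul_posPart, map_zero, zero_mul]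
    have hmem : z * star z ∈ annihilator κ hk := by
      have h1 : θ q⁻ * κ (z * star z) = 0 := by rw [map_mul, ← mul_assoc, hkz, zero_mul]
      refine ⟨h1, ?_⟩
      have h2 := congrArg star h1
      rwa [star_mul, hk.star_eq, star_zero, ← map_star, star_mul, star_star] at h2
    intro hbot
    rw [hbot, NonUnitalStarAlgebra.mem_bot, CStarRing.mul_star_self_eq_zero_iff] at hmem
    exact hy (Subtype.ext (hz.symm.trans hmem))
  · have hxs : IsSelfAdjoint (κ x) := hx0.isSelfAdjoint.map κ
    have hxn : ‖κ x‖ = 1 := by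
      rw [NonUnitalStarAlgHom.norm_map κ LocalMultiplierAlgebra.embedding_injective, hx1]
    have h1 := le_norm_conjugate_of_mul_eq_zero ht0.le hxs hxn hc hx.1
    rw [← hθ] at h1
    have h2 : ‖κ x * θ μ * κ x - κ x * m * κ x‖ ≤ ‖m‖ / 4 := by
      have h3 : κ x * θ μ * κ x - κ x * m * κ x = star (κ x) * (θ μ - m) * κ x := by
        rw [hxs.star_eq]; noncomm_ring
      rw [h3]
      refine (norm_conjugate_le _ _).trans ?_
      rw [hxn, one_pow, mul_one, norm_sub_rev]
      exact hv.le
    have h4 := norm_le_norm_add_norm_sub' (κ x * θ μ * κ x) (κ x * m * κ x)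
    linarith

theorem GeneralisedExpectation.IsEssentiallyDefined.isSupportive {B A' : Type*}
    [NonUnitalCStarAlgebra B] [NonUnitalCStarAlgebra A'] [PartialOrder A] [StarOrderedRing A]
    [PartialOrder B] [StarOrderedRing B] [PartialOrder A'] [StarOrderedRing A']
    {ι : A →⋆ₙₐ[ℂ] B} {j : A →⋆ₙₐ[ℂ] A'} {E : GeneralisedExpectation ι j}
    (hE : E.IsEssentiallyDefined) : E.IsSupportive := by
  obtain ⟨Φ, hΦ, hΦj⟩ := hE
  intro b hb hb0
  obtain ⟨w, hw⟩ := exists_eq_star_mul_self_of_nonneg (map_nonneg E.toCompletelyPositiveMap hb)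
  obtain ⟨δ, hδ, D, hD, hD0, h⟩ := exists_isHereditary_le_norm (m := Φ (E b))
    ⟨Φ w, by rw [hw, map_mul, map_star]⟩ ((map_ne_zero_iff Φ hΦ).2 hb0)
  refine ⟨δ, hδ, D, hD, hD0, fun x hx hx0 hx1 => (h x hx hx0 hx1).trans_eq ?_⟩
  rw [← NonUnitalStarAlgHom.norm_map Φ hΦ, map_mul, map_mul, hΦj]

end Local

end AperiodicInclusion

theorem mainTheorem1
    {A : Type*} {B : Type*} {A' : Type*}
    [NonUnitalCStarAlgebra A] [PartialOrder A] [StarOrderedRing A] [Nontrivial A]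
    [NonUnitalCStarAlgebra B] [PartialOrder B] [StarOrderedRing B]
    [NonUnitalCStarAlgebra A'] [PartialOrder A'] [StarOrderedRing A']
    (ι : A →⋆ₙₐ[ℂ] B) (hι : Function.Injective ι)
    (j : A →⋆ₙₐ[ℂ] A') (hj : Function.Injective j)
    (E : AperiodicInclusion.GeneralisedExpectation ι j)
    (hap : AperiodicInclusion.IsAperiodic ι)
    (hE : E.IsSupportive ∨ E.IsEssentiallyDefined) :
    -- essentially defined conditional expectations are supportive
    E.IsSupportive ∧
    -- positive elements outside the null ideal dominate nonzero positive elements of `A`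
    (∀ b : B, 0 ≤ b → b ∉ E.nullIdeal →
      ∃ a : A, 0 ≤ a ∧ a ≠ 0 ∧ AperiodicInclusion.CuntzBelow (ι a) b) ∧
    -- `A⁺` supports `B / 𝒩_E`
    AperiodicInclusion.Supports (E.nullIdeal.quotMap.comp ι) ∧
    -- `A` detects ideals in `B / 𝒩_E`
    AperiodicInclusion.DetectsIdeals (E.nullIdeal.quotMap.comp ι) ∧
    -- `𝒩_E` is the hidden ideal, followed by the equivalent descriptions of this property
    AperiodicInclusion.IsHiddenIdeal ι E.nullIdeal ∧
    (∀ J : AperiodicInclusion.ClosedIdeal B,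
      (Function.Injective (J.quotMap.comp ι) ∧
        AperiodicInclusion.DetectsIdeals (J.quotMap.comp ι)) ↔ J = E.nullIdeal) ∧
    (∀ J : AperiodicInclusion.ClosedIdeal B, AperiodicInclusion.MeetsTrivially ι J →
      ∀ x ∈ J, E x = 0) ∧
    (∀ J : AperiodicInclusion.ClosedIdeal B, AperiodicInclusion.MeetsTrivially ι J →
      J ≤ E.nullIdeal) ∧
    (∀ (C : Type*) [NonUnitalCStarAlgebra C] (π : B →⋆ₙₐ[ℂ] C),
      Function.Injective (π.comp ι) →
        ∃ φ : AperiodicInclusion.Image π →⋆ₙₐ[ℂ] E.nullIdeal.Quot,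
          φ.comp (AperiodicInclusion.toImage π) = E.nullIdeal.quotMap) ∧
    (∀ (C : Type*) [NonUnitalCStarAlgebra C] (π : B →⋆ₙₐ[ℂ] C),
      Function.Injective (π.comp ι) →
        ∃ Eπ : AperiodicInclusion.GeneralisedExpectation
            ((AperiodicInclusion.toImage π).comp ι) j,
          ∀ b : B, Eπ (AperiodicInclusion.toImage π b) = E b) ∧
    -- simplicity
    (AperiodicInclusion.IsSimple B ↔
      AperiodicInclusion.IsMinimal ι ∧ E.IsAlmostFaithful) ∧
    -- pure infiniteness
    (AperiodicInclusion.IsSimple B →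
      (AperiodicInclusion.IsPurelyInfinite B ↔
        ∀ a : A, 0 ≤ a → a ≠ 0 → AperiodicInclusion.IsInfinite (ι a))) := by
  have hE' : E.IsSupportive := hE.elim id fun h => h.isSupportive
  have hmt := E.meetsTrivially_nullIdeal hj
  have hle (J : AperiodicInclusion.ClosedIdeal B) (hJ : AperiodicInclusion.MeetsTrivially ι J) :
      J ≤ E.nullIdeal := E.le_nullIdeal_of_meetsTrivially hι hj hap hE' hJ
  have hker (J : AperiodicInclusion.ClosedIdeal B) (hJ : AperiodicInclusion.MeetsTrivially ι J) :
      ∀ x ∈ J, E x = 0 := fun x hx => E.apply_eq_zero_of_mem_nullIdeal (hle J hJ hx)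
  have hsupp := E.supports_quotient hι hj hap hE'
  have hdet := hsupp.detectsIdeals (hmt.injective hι)
  refine ⟨hE', fun b hb => E.exists_cuntzBelow_of_notMem_nullIdeal hι hj hap hE' hb, hsupp, hdet,
    ⟨⟨hmt, fun J hJ _ => hle J hJ⟩, fun J hJ =>
      le_antisymm (hle J hJ.1) (hJ.2 hmt (hle J hJ.1))⟩,
    fun J => ⟨fun ⟨h1, h2⟩ => ?_, ?_⟩, hker, hle, fun C _ π hπ => ?_, fun C _ π hπ => ?_,
    ⟨fun hB => ⟨hB.isMinimal hι,
      (AperiodicInclusion.isAlmostFaithful_iff E).2 (hB.nullIdeal_eq_bot hι hj E)⟩,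
      fun ⟨hmin, hf⟩ => ?_⟩,
    fun hB => ⟨fun hpi a ha ha0 => ?_, fun h => ?_⟩⟩
  · have hJ : AperiodicInclusion.MeetsTrivially ι J := by
      have := AperiodicInclusion.meetsTrivially_kerIdeal h1
      rwa [AperiodicInclusion.kerIdeal_quotMap] at this
    exact AperiodicInclusion.eq_of_le_of_detectsIdeals (hle J hJ) hmt h2
  · rintro rfl
    exact ⟨hmt.injective hι, hdet⟩
  · refine AperiodicInclusion.exists_factor_of_kerIdeal_le
      (AperiodicInclusion.toImage_surjective π) ?_
    rw [AperiodicInclusion.kerIdeal_toImage, AperiodicInclusion.kerIdeal_quotMap]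
    exact hle _ (AperiodicInclusion.meetsTrivially_kerIdeal hπ)
  · exact E.exists_descend π (hker _ (AperiodicInclusion.meetsTrivially_kerIdeal hπ))
  · rw [AperiodicInclusion.isAlmostFaithful_iff] at hf
    refine AperiodicInclusion.isSimple_of_isMinimal_of_detectsIdeals hι hmin fun J hJ hm => hJ ?_
    have h := hle J hm
    rw [hf] at h
    exact AperiodicInclusion.ClosedIdeal.eq_bot_iff.2 h
  · exact hB.isInfinite_of_isPurelyInfinite hpi (map_nonneg ι ha) ((map_ne_zero_iff ι hι).2 ha0)
  · refine hB.isPurelyInfinite fun b hb hb0 => ?_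
    obtain ⟨a, ha, ha0, hab⟩ := E.exists_cuntzBelow_of_notMem_nullIdeal hι hj hap hE' hb
      (by rw [hB.nullIdeal_eq_bot hι hj E]; exact hb0)
    exact ⟨ι a, h a ha ha0, hab⟩
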